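/- Let $M$ be a model of Quine's New Foundations (NF): extensionality, and comprehension for every stratifiable formula of the language of set theory. Write $\langle x,y\rangle$ for Quine's type-level pair, $\langle x,y\rangle=\{\varphi(a):a\in x\}\cup\{\varphi(b)\cup\{0\}:b\in y\}$, where $\varphi(a)$ replaces each (Frege) natural number $n\in a$ by $n+1$ and keeps the other elements of $a$. In $M$ this is an ordered pair: $\langle x,y\rangle=\langle x',y'\rangle$ implies $x=x'$ and $y=y'$. Hence one can form the category $\mathbf N$ of NF sets, whose objects are the sets of $M$ and whose arrows $A\to B$ are the functions of $M$ from $A$ to $B$ (sets of Quine pairs). It has finite products, with $A\times B=\{\langle a,b\rangle: a\in A,\ b\in B\}$. Let $T:\mathbf N\to\mathbf N$ be the functor with $TA=\{\{a\}:a\in A\}$ and $Tf(\{a\})=\{f(a)\}$. Let $A\Rightarrow B$ be the set of all functions from $A$ to $B$; for fixed $A$ it gives a functor $A\Rightarrow-:\mathbf N\to\mathbf N$ that acts on arrows by postcomposition. Let $ev'_{A,B}:TA\times(A\Rightarrow B)\to TB$ be the function $\langle\{a\},f\rangle\mapsto\{f(a)\}$. For functors $J:\mathscr E\to\mathscr D$,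 $F:\mathscr E\to\mathscr C$ and $G:\mathscr C\to\mathscr D$, a relative adjunction $F\;{}_J\!\dashv G$ is a bijection $\hom(FX,Y)\cong\hom(JX,GY)$, and a relative adjunction $G\dashv_J F$ is a bijection $\hom(Y,FX)\cong\hom(GY,JX)$, each natural in $X$ and $Y$; the counit of the latter has as components $GFX\to JX$ the images of the identities of $FX$. A category with finite products and an endofunctor $T$ is pseudo-cartesian closed if for every object $A$ there is an endofunctor $A\Rightarrow-$ with $(TA\times-)\dashv_T(A\Rightarrow-)$ and $(A\times-)\;{}_T\!\dashv(A\Rightarrow-)$. Then: 1. For all $A,B$, the pair $\langle A\Rightarrow B,\,ev'_{A,B}\rangle$ is a $(TA\times-)$-co-universal arrow to $TB$: for all $C$ and $g:TA\times C\to TB$ there is a unique $k:C\to(A\Rightarrow B)$ with $ev'_{A,B}\circ(\mathrm{id}_{TA}\times k)=g$. 2. For every $A$ there is a relative adjunction $(TA\times-)\dashv_T(A\Rightarrow-)$ whose counit is $ev'_{A,-}$. 3. For every $A$ there is a relative adjunction $(A\times-)\;{}_T\!\dashv(A\Rightarrow-)$. 4. Consequently $\mathbf N$, with the functor $T$, is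 pseudo-cartesian closed. -/

import Mathlib

open FirstOrder CategoryTheory MonoidalCategory CartesianMonoidalCategory Limits

universe u v₁ v₂ v₃ u₁ u₂ u₃

/-! ## The theory NF and its models -/

/-- The relation symbols of the language of set theory: one binary symbol. -/
inductive MemRel : ℕ → Type
  | mem : MemRel 2

/-- The first-order language of set theory, with membership as its only non-logical symbol. -/
def setLang : FirstOrder.Language.{0, 0} := ⟨fun _ => Empty, MemRel⟩

namespace NF

/-- `x ∈ₙ y`: the membership relation of a structure for the language of set theory. -/
def Mem {M : Type u} [setLang.Structure M] (x y : M) : Prop :=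
  Language.Structure.RelMap (L := setLang) MemRel.mem ![x, y]

infix:50 " ∈ₙ " => NF.Mem

/-- The type which `σ` assigns to a term. All terms are variables. -/
def termType {n : ℕ} (σ : Fin n → ℕ) : setLang.Term (Empty ⊕ Fin n) → ℕ
  | .var (.inl e) => e.elim
  | .var (.inr i) => σ i
  | .func f _ => Empty.elim f

/-- `StratifiedBy σ φ`: the assignment `σ` of types to the free variables of `φ` extends to a
stratification of `φ`. Variables are de Bruijn levels, so each quantifier binds a new variable,
which gets one type of its own. -/
def StratifiedBy : {n : ℕ} → (Fin n → ℕ) → setLang.BoundedFormula Empty n → Prop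
  | _, _, .falsum => True
  | _, σ, .equal s t => termType σ s = termType σ t
  | _, σ, .rel (l := _) R ts =>
      match R, ts with
      | .mem, ts => termType σ (ts 0) + 1 = termType σ (ts 1)
  | _, σ, .imp φ ψ => StratifiedBy σ φ ∧ StratifiedBy σ ψ
  | _, σ, .all φ => ∃ k : ℕ, StratifiedBy (Fin.snoc σ k) φ

/-- A formula is stratifiable if it has a stratification. -/
def Stratifiable {n : ℕ} (φ : setLang.BoundedFormula Empty n) : Prop :=
  ∃ σ : Fin n → ℕ, StratifiedBy σ φ

end NF

/-- `M` is a model of Quine's New Foundations: extensionality, and comprehension for every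
stratifiable formula `φ(x₀, …, xₙ₋₁, z)`. -/
class NFModel (M : Type u) [setLang.Structure M] : Prop where
  ext : ∀ x y : M, (∀ z : M, z ∈ₙ x ↔ z ∈ₙ y) → x = y
  comprehension : ∀ {n : ℕ} (φ : setLang.BoundedFormula Empty (n + 1)), NF.Stratifiable φ →
    ∀ x : Fin n → M, ∃ y : M, ∀ z : M, z ∈ₙ y ↔ φ.Realize default (Fin.snoc x z)

namespace NF

section Stratified

variable {M : Type u} [setLang.Structure M]

open Classical in
/-- The set of the model whose elements are exactly the `z` with `P z`. It is only used for classes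
that are shown below to be sets of the model. -/
noncomputable def setOf [NFModel M] (P : M → Prop) : M :=
  if h : ∃ y : M, ∀ z, z ∈ₙ y ↔ P z then h.choose
  else (NFModel.comprehension (M := M) (n := 0) .falsum ⟨fun _ => 0, trivial⟩ default).choose

/-- The predicates on the model that are defined by formulas with the given stratification: a
working form of stratified definability. -/
inductive SP : {n : ℕ} → (Fin n → ℕ) → ((Fin n → M) → Prop) → Prop
  | falsum {n : ℕ} (σ : Fin n → ℕ) : SP σ (fun _ => False)
  | eq {n : ℕ} (σ : Fin n → ℕ) (i j : Fin n) : σ i = σ j → SP σ (fun v => v i = v j)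
  | mem {n : ℕ} (σ : Fin n → ℕ) (i j : Fin n) : σ i + 1 = σ j → SP σ (fun v => v i ∈ₙ v j)
  | imp {n : ℕ} {σ : Fin n → ℕ} {P Q : (Fin n → M) → Prop} :
      SP σ P → SP σ Q → SP σ (fun v => P v → Q v)
  | all {n : ℕ} {σ : Fin n → ℕ} (k : ℕ) {P : (Fin (n + 1) → M) → Prop} :
      SP (Fin.snoc σ k : Fin (n + 1) → ℕ) P → SP σ (fun v => ∀ x : M, P (Fin.snoc v x))

theorem SP.exists_formula {n : ℕ} {σ : Fin n → ℕ} {P : (Fin n → M) → Prop} (h : SP σ P) :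
    ∃ φ : setLang.BoundedFormula Empty n, StratifiedBy σ φ ∧
      ∀ v, φ.Realize default v ↔ P v := by
  induction h with
  | falsum σ => exact ⟨.falsum, trivial, fun v => Iff.rfl⟩
  | eq σ i j h => exact ⟨.equal (.var (.inr i)) (.var (.inr j)), h, fun v => Iff.rfl⟩
  | mem σ i j h =>
    refine ⟨.rel (l := 2) MemRel.mem ![.var (.inr i), .var (.inr j)], h, fun v => ?_⟩
    simp only [Language.BoundedFormula.Realize, Mem]
    apply iff_of_eq
    congr 1
    funext a
    fin_cases a <;> rfl
  | imp _ _ ih₁ ih₂ =>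
    obtain ⟨φ, hφ, eφ⟩ := ih₁
    obtain ⟨ψ, hψ, eψ⟩ := ih₂
    exact ⟨.imp φ ψ, ⟨hφ, hψ⟩, fun v => imp_congr (eφ v) (eψ v)⟩
  | all k _ ih =>
    obtain ⟨φ, hφ, eφ⟩ := ih
    exact ⟨.all φ, ⟨k, hφ⟩, fun v => forall_congr' fun x => eφ _⟩

theorem SP.congr {n : ℕ} {σ : Fin n → ℕ} {P Q : (Fin n → M) → Prop} (h : SP σ P)
    (e : ∀ v, P v ↔ Q v) : SP σ Q := by
  have : P = Q := funext fun v => propext (e v)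
  exact this ▸ h

theorem SP.not {n : ℕ} {σ : Fin n → ℕ} {P : (Fin n → M) → Prop} (h : SP σ P) :
    SP σ (fun v => ¬ P v) := h.imp (.falsum σ)

theorem SP.or {n : ℕ} {σ : Fin n → ℕ} {P Q : (Fin n → M) → Prop} (h : SP σ P) (h₂ : SP σ Q) :
    SP σ (fun v => P v ∨ Q v) := (h.not.imp h₂).congr fun v => by tauto

theorem SP.and {n : ℕ} {σ : Fin n → ℕ} {P Q : (Fin n → M) → Prop} (h : SP σ P) (h₂ : SP σ Q) :
    SP σ (fun v => P v ∧ Q v) := (h.imp h₂.not).not.congr fun v => by tauto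

theorem SP.iff {n : ℕ} {σ : Fin n → ℕ} {P Q : (Fin n → M) → Prop} (h : SP σ P) (h₂ : SP σ Q) :
    SP σ (fun v => P v ↔ Q v) := ((h.imp h₂).and (h₂.imp h)).congr fun v => by tauto

theorem SP.forall {n : ℕ} {σ : Fin n → ℕ} (k : ℕ) {P : (Fin n → M) → M → Prop}
    (h : SP (Fin.snoc σ k : Fin (n + 1) → ℕ) (fun w => P (Fin.init w) (w (Fin.last n)))) :
    SP σ (fun v => ∀ x, P v x) :=
  (SP.all k h).congr fun v => by simp

theorem SP.exists {n : ℕ} {σ : Fin n → ℕ} (k : ℕ) {P : (Fin n → M) → M → Prop}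
    (h : SP (Fin.snoc σ k : Fin (n + 1) → ℕ) (fun w => P (Fin.init w) (w (Fin.last n)))) :
    SP σ (fun v => ∃ x, P v x) :=
  (SP.forall k (P := fun v x => ¬ P v x) h.not).not.congr fun v => by simp

theorem SP.rename {n : ℕ} {σ : Fin n → ℕ} {P : (Fin n → M) → Prop} (h : SP σ P) :
    ∀ {m : ℕ} (τ : Fin m → ℕ) (f : Fin n → Fin m), (∀ i, τ (f i) = σ i) →
      SP τ (fun v => P (v ∘ f)) := by
  induction h with
  | falsum σ => intro m τ f _; exact .falsum τ
  | eq σ i j h => intro m τ f e; exact .eq τ (f i) (f j) (by rw [e, e, h])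
  | mem σ i j h => intro m τ f e; exact .mem τ (f i) (f j) (by rw [e, e, h])
  | imp _ _ ih₁ ih₂ => intro m τ f e; exact (ih₁ τ f e).imp (ih₂ τ f e)
  | @all n σ k P _ ih =>
    intro m τ f e
    have := ih (Fin.snoc τ k : Fin (m + 1) → ℕ)
      (Fin.snoc (fun i => (f i).castSucc) (Fin.last m) : Fin (n + 1) → Fin (m + 1)) (by
        intro i
        refine Fin.lastCases ?_ (fun i => ?_) i <;> simp [e])
    refine (SP.all k this).congr fun v => forall_congr' fun x => iff_of_eq (congrArg P ?_)
    funext i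
    refine Fin.lastCases ?_ (fun i => ?_) i <;> simp

theorem SP.weak {n : ℕ} {σ : Fin n → ℕ} {P : (Fin n → M) → Prop} (h : SP σ P) {j : ℕ} :
    SP (Fin.snoc σ j : Fin (n + 1) → ℕ) (fun w => P (Fin.init w)) :=
  h.rename _ Fin.castSucc (by simp)

/-- Stratified definability of a function of the model, with values of type `k`. -/
def ST {n : ℕ} (σ : Fin n → ℕ) (k : ℕ) (t : (Fin n → M) → M) : Prop :=
  SP (Fin.snoc σ k : Fin (n + 1) → ℕ) (fun w => w (Fin.last n) = t (Fin.init w))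

theorem ST.var' {n : ℕ} {σ : Fin n → ℕ} (i : Fin n) {k : ℕ} (h : σ i = k) :
    ST (M := M) σ k (fun v => v i) :=
  (SP.eq (Fin.snoc σ k : Fin (n + 1) → ℕ) (Fin.last n) i.castSucc (by simp [h])).congr
    fun v => Iff.rfl

theorem ST.last {n : ℕ} {σ : Fin n → ℕ} {k : ℕ} :
    ST (M := M) (Fin.snoc σ k : Fin (n + 1) → ℕ) k (fun w => w (Fin.last n)) :=
  ST.var' (Fin.last n) (by simp)

theorem ST.weak {n : ℕ} {σ : Fin n → ℕ} {k : ℕ} {t : (Fin n → M) → M} (h : ST σ k t) {j : ℕ} :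
    ST (Fin.snoc σ j : Fin (n + 1) → ℕ) k (fun w => t (Fin.init w)) := by
  have := SP.rename h (Fin.snoc (Fin.snoc σ j : Fin (n + 1) → ℕ) k : Fin (n + 2) → ℕ)
    (Fin.snoc (fun i => i.castSucc.castSucc) (Fin.last (n + 1)) : Fin (n + 1) → Fin (n + 2)) (by
      intro i
      refine Fin.lastCases ?_ (fun i => ?_) i <;> simp)
  refine this.congr fun v => ?_
  have e : (Fin.init (v ∘ (Fin.snoc (fun i => i.castSucc.castSucc) (Fin.last (n + 1)) :
      Fin (n + 1) → Fin (n + 2))) : Fin n → M) = Fin.init (Fin.init v : Fin (n + 1) → M) := by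
    funext i
    simp [Fin.init]
  simp [e]

theorem ST.mem {n : ℕ} {σ : Fin n → ℕ} (k : ℕ) {s t : (Fin n → M) → M} (hs : ST σ k s)
    (ht : ST σ (k + 1) t) : SP σ (fun v => s v ∈ₙ t v) := by
  have h : SP σ (fun v => ∃ x, x = s v ∧ ∃ y, y = t v ∧ x ∈ₙ y) := by
    refine SP.exists k (SP.and hs ?_)
    refine SP.exists (P := fun w y => y = t (Fin.init w) ∧ w (Fin.last n) ∈ₙ y) (k + 1)
      (SP.and (ht.weak) ?_)
    refine (SP.mem _ (Fin.last n).castSucc (Fin.last (n + 1)) ?_).congr fun v => Iff.rfl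
    simp
  exact h.congr fun v => by simp

theorem ST.eq {n : ℕ} {σ : Fin n → ℕ} (k : ℕ) {s t : (Fin n → M) → M} (hs : ST σ k s)
    (ht : ST σ k t) : SP σ (fun v => s v = t v) := by
  have h : SP σ (fun v => ∃ x, x = s v ∧ x = t v) := SP.exists k (SP.and hs ht)
  exact h.congr fun v => by simp

variable [NFModel M]

theorem mem_setOf {n : ℕ} {σ : Fin n → ℕ} {k : ℕ} {P : (Fin n → M) → M → Prop}
    (h : SP (Fin.snoc σ k : Fin (n + 1) → ℕ) (fun w => P (Fin.init w) (w (Fin.last n))))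
    (v : Fin n → M) (z : M) : z ∈ₙ setOf (P v) ↔ P v z := by
  obtain ⟨φ, hφ, e⟩ := h.exists_formula
  have H : ∃ y : M, ∀ z, z ∈ₙ y ↔ P v z := by
    obtain ⟨y, hy⟩ := NFModel.comprehension φ ⟨_, hφ⟩ v
    exact ⟨y, fun z => by rw [hy, e]; simp⟩
  rw [setOf, dif_pos H]
  exact H.choose_spec z

theorem ST.setOf {n : ℕ} {σ : Fin n → ℕ} {k : ℕ} {P : (Fin n → M) → M → Prop}
    (h : SP (Fin.snoc σ k : Fin (n + 1) → ℕ) (fun w => P (Fin.init w) (w (Fin.last n)))) :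
    ST σ (k + 1) (fun v => NF.setOf (P v)) := by
  have hP := SP.rename h (Fin.snoc (Fin.snoc σ (k + 1) : Fin (n + 1) → ℕ) k : Fin (n + 2) → ℕ)
    (Fin.snoc (fun i => i.castSucc.castSucc) (Fin.last (n + 1)) : Fin (n + 1) → Fin (n + 2)) (by
      intro i
      refine Fin.lastCases ?_ (fun i => ?_) i <;> simp)
  have h₁ : SP (Fin.snoc σ (k + 1) : Fin (n + 1) → ℕ)
      (fun w => ∀ z : M, z ∈ₙ w (Fin.last n) ↔ P (Fin.init w) z) := by
    refine SP.forall k (SP.iff (ST.mem k ST.last ST.last.weak) (hP.congr fun v => ?_))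
    have e : (Fin.init (v ∘ (Fin.snoc (fun i => i.castSucc.castSucc) (Fin.last (n + 1)) :
        Fin (n + 1) → Fin (n + 2))) : Fin n → M) = Fin.init (Fin.init v : Fin (n + 1) → M) := by
      funext i
      simp [Fin.init]
    simp [e]
  refine h₁.congr fun w => ⟨fun hw => ?_, fun hw z => ?_⟩
  · exact NFModel.ext _ _ fun z => by rw [hw, mem_setOf h]
  · rw [hw, mem_setOf h]

end Stratified

/-! ## Basic sets, Quine's type-level ordered pair -/

section Sets

variable {M : Type u} [setLang.Structure M] [NFModel M]

variable (M) in
/-- The empty set. -/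
noncomputable def empty : M := setOf fun _ => False

/-- The singleton `ι‘x = {x}`. -/
noncomputable def sing (x : M) : M := setOf fun z => z = x

/-- `x ∪ y`. -/
noncomputable def union (x y : M) : M := setOf fun z => z ∈ₙ x ∨ z ∈ₙ y

variable (M) in
/-- Frege's zero `{∅}`. -/
noncomputable def zero : M := sing (empty M)

/-- Frege's successor `{x ∪ {y} : x ∈ n, y ∉ x}`. -/
noncomputable def succ (n : M) : M :=
  setOf fun z => ∃ x, x ∈ₙ n ∧ ∃ y, ¬ y ∈ₙ x ∧ z = union x (sing y)

variable (M) in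
/-- The set of Frege natural numbers: the intersection of all sets that contain zero and are closed
under successor. -/
noncomputable def nat : M :=
  setOf fun n => ∀ X, (zero M ∈ₙ X ∧ ∀ m, m ∈ₙ X → succ m ∈ₙ X) → n ∈ₙ X

/-- Quine's operation `φ`, which adds one to every natural number in `a` and keeps the other
elements of `a`. -/
noncomputable def shift (a : M) : M :=
  setOf fun z => (∃ n, n ∈ₙ a ∧ n ∈ₙ nat M ∧ z = succ n) ∨ (z ∈ₙ a ∧ ¬ z ∈ₙ nat M)

/-- Quine's ordered pair `⟨x, y⟩ = {φ(a) : a ∈ x} ∪ {φ(b) ∪ {0} : b ∈ y}`. -/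
noncomputable def pair (x y : M) : M :=
  setOf fun z => (∃ a, a ∈ₙ x ∧ z = shift a) ∨ (∃ b, b ∈ₙ y ∧ z = union (shift b) (sing (zero M)))

variable (M) in
/-- Quine's ordered pairs determine their components in `M`. -/
def QuinePairing : Prop :=
  ∀ x y x' y' : M, pair x y = pair x' y' → x = x' ∧ y = y'

variable {n : ℕ} {σ : Fin n → ℕ} {k : ℕ} {s t : (Fin n → M) → M}

theorem ST.empty : ST σ (k + 1) (fun _ => empty M) := ST.setOf (k := k) (.falsum _)

theorem ST.sing (h : ST σ k t) : ST σ (k + 1) (fun v => sing (t v)) :=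
  ST.setOf (ST.eq k ST.last h.weak)

theorem ST.union (hs : ST σ (k + 1) s) (ht : ST σ (k + 1) t) :
    ST σ (k + 1) (fun v => union (s v) (t v)) :=
  ST.setOf ((ST.mem k ST.last hs.weak).or (ST.mem k ST.last ht.weak))

theorem ST.zero : ST σ (k + 2) (fun _ => zero M) := ST.empty.sing

theorem ST.succ (h : ST σ (k + 2) t) : ST σ (k + 2) (fun v => succ (t v)) := by
  refine ST.setOf (k := k + 1) (SP.exists (k + 1) ((ST.mem (k + 1) ST.last h.weak.weak).and ?_))
  refine SP.exists k ((ST.mem k ST.last ST.last.weak).not.and ?_)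
  exact ST.eq (k + 1) ST.last.weak.weak (ST.union ST.last.weak ST.last.sing)

theorem ST.nat : ST σ (k + 3) (fun _ => nat M) := by
  refine ST.setOf (k := k + 2) (SP.forall (k + 3) (SP.imp (SP.and ?_ ?_) ?_))
  · exact ST.mem (k + 2) ST.zero ST.last
  · exact SP.forall (k + 2) ((ST.mem (k + 2) ST.last ST.last.weak).imp
      (ST.mem (k + 2) ST.last.succ ST.last.weak))
  · exact ST.mem (k + 2) ST.last.weak ST.last

theorem ST.shift (h : ST σ (k + 3) t) : ST σ (k + 3) (fun v => shift (t v)) := by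
  refine ST.setOf (k := k + 2) (SP.or ?_ ?_)
  · exact SP.exists (k + 2) ((ST.mem (k + 2) ST.last h.weak.weak).and
      ((ST.mem (k + 2) ST.last ST.nat).and (ST.eq (k + 2) ST.last.weak ST.last.succ)))
  · exact (ST.mem (k + 2) ST.last h.weak).and (ST.mem (k + 2) ST.last ST.nat).not

theorem ST.pair (hs : ST σ (k + 4) s) (ht : ST σ (k + 4) t) :
    ST σ (k + 4) (fun v => pair (s v) (t v)) := by
  refine ST.setOf (k := k + 3) (SP.or ?_ ?_)
  · exact SP.exists (k + 3) ((ST.mem (k + 3) ST.last hs.weak.weak).and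
      (ST.eq (k + 3) ST.last.weak ST.last.shift))
  · exact SP.exists (k + 3) ((ST.mem (k + 3) ST.last ht.weak.weak).and
      (ST.eq (k + 3) ST.last.weak (ST.union ST.last.shift ST.zero.sing)))

theorem mem_empty (z : M) : ¬ z ∈ₙ empty M :=
  (mem_setOf (σ := (default : Fin 0 → ℕ)) (k := 0) (P := fun _ _ => False) (.falsum _) default z).mp

theorem mem_sing (x z : M) : z ∈ₙ sing x ↔ z = x :=
  mem_setOf (σ := ![0]) (k := 0) (P := fun v z => z = v 0)
    (ST.eq 0 ST.last (ST.var' 0 rfl).weak) ![x] z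

theorem sing_inj {x y : M} (h : sing x = sing y) : x = y := by
  rw [← mem_sing, ← h, mem_sing]

end Sets

/-! ## Functions as sets of ordered pairs -/

section Functions

variable {M : Type u} [setLang.Structure M] [NFModel M]

/-- `f` is a function from `A` to `B`: a set of ordered pairs that is contained in `A × B` and
contains exactly one pair `⟨a, b⟩` for each `a ∈ A`. -/
def IsFun (A B f : M) : Prop :=
  (∀ p, p ∈ₙ f → ∃ a, a ∈ₙ A ∧ ∃ b, b ∈ₙ B ∧ p = pair a b) ∧
    ∀ a, a ∈ₙ A → ∃! b, pair a b ∈ₙ f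

/-- The set of all ordered pairs `⟨a, b⟩` with `R a b`. -/
noncomputable def graph (R : M → M → Prop) : M := setOf fun p => ∃ a b, R a b ∧ p = pair a b

/-- `ι‘‘A = {{a} : a ∈ A}`. -/
noncomputable def singImage (A : M) : M := setOf fun z => ∃ a, a ∈ₙ A ∧ z = sing a

/-- The product set `A × B`. -/
noncomputable def prod (A B : M) : M :=
  setOf fun p => ∃ a, a ∈ₙ A ∧ ∃ b, b ∈ₙ B ∧ p = pair a b

/-- `A ⇒ B`: the set of all functions from `A` to `B`. -/
noncomputable def funSet (A B : M) : M := setOf fun f => IsFun A B f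

/-- The composite `g ∘ f = {⟨a, c⟩ : ⟨a, b⟩ ∈ f and ⟨b, c⟩ ∈ g for some b}`. -/
noncomputable def compSet (f g : M) : M := graph fun a c => ∃ b, pair a b ∈ₙ f ∧ pair b c ∈ₙ g

variable {n : ℕ} {σ : Fin n → ℕ} {k : ℕ} {s t : (Fin n → M) → M}

theorem SP.graph {R : (Fin n → M) → M → M → Prop}
    (h : SP (Fin.snoc (Fin.snoc σ (k + 4) : Fin (n + 1) → ℕ) (k + 4) : Fin (n + 2) → ℕ)
      (fun w => R (Fin.init (Fin.init w : Fin (n + 1) → M)) (Fin.init w (Fin.last n))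
        (w (Fin.last (n + 1))))) :
    SP (Fin.snoc σ (k + 4) : Fin (n + 1) → ℕ)
      (fun w => ∃ a b, R (Fin.init w) a b ∧ w (Fin.last n) = pair a b) := by
  refine SP.exists (k + 4) (SP.exists (P := fun w b => R (Fin.init (Fin.init w : Fin (n + 1) → M))
    (w (Fin.last (n + 1))) b ∧ Fin.init w (Fin.last n) = pair (w (Fin.last (n + 1))) b)
    (k + 4) (SP.and ?_ ?_))
  · have := h.rename (Fin.snoc (Fin.snoc (Fin.snoc σ (k + 4) : Fin (n + 1) → ℕ) (k + 4) :
      Fin (n + 2) → ℕ) (k + 4) : Fin (n + 3) → ℕ)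
      (Fin.snoc (Fin.snoc (fun i => i.castSucc.castSucc.castSucc) (Fin.last (n + 1)).castSucc :
        Fin (n + 1) → Fin (n + 3)) (Fin.last (n + 2)) : Fin (n + 2) → Fin (n + 3)) (by
        intro i
        refine Fin.lastCases ?_ (fun i => ?_) i
        · simp
        · refine Fin.lastCases ?_ (fun i => ?_) i <;> simp)
    refine this.congr fun v => iff_of_eq ?_
    refine _root_.congr (_root_.congr (congrArg R ?_) ?_) ?_
    · funext i
      simp [Fin.init]
    · simp [Fin.init]
    · simp
  · exact ST.eq (k + 4) ST.last.weak.weak (ST.pair ST.last.weak ST.last)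

theorem ST.graph {R : (Fin n → M) → M → M → Prop}
    (h : SP (Fin.snoc (Fin.snoc σ (k + 4) : Fin (n + 1) → ℕ) (k + 4) : Fin (n + 2) → ℕ)
      (fun w => R (Fin.init (Fin.init w : Fin (n + 1) → M)) (Fin.init w (Fin.last n))
        (w (Fin.last (n + 1))))) :
    ST σ (k + 5) (fun v => graph (R v)) :=
  ST.setOf (P := fun v p => ∃ a b, R v a b ∧ p = NF.pair a b) (SP.graph h)

/-- The pairs `⟨a, b⟩` with `R a b` form a set. -/
def IsGraph (R : M → M → Prop) : Prop :=
  ∀ p, p ∈ₙ graph R ↔ ∃ a b, R a b ∧ p = pair a b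

theorem isGraph {R : (Fin n → M) → M → M → Prop}
    (h : SP (Fin.snoc (Fin.snoc σ (k + 4) : Fin (n + 1) → ℕ) (k + 4) : Fin (n + 2) → ℕ)
      (fun w => R (Fin.init (Fin.init w : Fin (n + 1) → M)) (Fin.init w (Fin.last n))
        (w (Fin.last (n + 1))))) (v : Fin n → M) : IsGraph (R v) :=
  fun p => mem_setOf (P := fun v p => ∃ a b, R v a b ∧ p = pair a b) (SP.graph h) v p

theorem IsGraph.pair_mem {R : M → M → Prop} (hR : IsGraph R) (h : QuinePairing M) {a b : M} :
    pair a b ∈ₙ graph R ↔ R a b := by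
  rw [hR]
  constructor
  · rintro ⟨a', b', hab, e⟩
    obtain ⟨rfl, rfl⟩ := h _ _ _ _ e
    exact hab
  · exact fun hab => ⟨a, b, hab, rfl⟩

theorem IsGraph.isFun {R : M → M → Prop} (hR : IsGraph R) (h : QuinePairing M) {A B : M}
    (hAB : ∀ a b, R a b → a ∈ₙ A ∧ b ∈ₙ B) (hex : ∀ a, a ∈ₙ A → ∃ b, R a b)
    (huniq : ∀ a b b', R a b → R a b' → b = b') : IsFun A B (graph R) := by
  refine ⟨fun p hp => ?_, fun a ha => ?_⟩
  · obtain ⟨a, b, hab, rfl⟩ := (hR p).mp hp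
    exact ⟨a, (hAB a b hab).1, b, (hAB a b hab).2, rfl⟩
  · obtain ⟨b, hb⟩ := hex a ha
    exact ⟨b, (hR.pair_mem h).mpr hb, fun b' hb' => huniq _ _ _ ((hR.pair_mem h).mp hb') hb⟩

theorem IsFun.dom {A B f a b : M} (hf : IsFun A B f) (h : QuinePairing M) (hab : pair a b ∈ₙ f) :
    a ∈ₙ A ∧ b ∈ₙ B := by
  obtain ⟨a', ha, b', hb, e⟩ := hf.1 _ hab
  obtain ⟨rfl, rfl⟩ := h _ _ _ _ e
  exact ⟨ha, hb⟩

theorem IsFun.uniq {A B f a b b' : M} (hf : IsFun A B f) (h : QuinePairing M)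
    (hab : pair a b ∈ₙ f) (hab' : pair a b' ∈ₙ f) : b = b' :=
  (hf.2 a (hf.dom h hab).1).unique hab hab'

theorem IsFun.ext {A B f g : M} (hf : IsFun A B f) (hg : IsFun A B g)
    (hfg : ∀ a b, pair a b ∈ₙ f ↔ pair a b ∈ₙ g) : f = g := by
  refine NFModel.ext _ _ fun p => ⟨fun hp => ?_, fun hp => ?_⟩
  · obtain ⟨a, _, b, _, rfl⟩ := hf.1 p hp
    exact (hfg a b).mp hp
  · obtain ⟨a, _, b, _, rfl⟩ := hg.1 p hp
    exact (hfg a b).mpr hp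

theorem ST.pair_mem {u : (Fin n → M) → M} (hs : ST σ (k + 4) s) (ht : ST σ (k + 4) t)
    (hu : ST σ (k + 5) u) : SP σ (fun v => NF.pair (s v) (t v) ∈ₙ u v) :=
  ST.mem (k + 4) (hs.pair ht) hu

theorem mem_singImage (A z : M) : z ∈ₙ singImage A ↔ ∃ a, a ∈ₙ A ∧ z = sing a :=
  mem_setOf (σ := ![1]) (k := 1) (P := fun v z => ∃ a, a ∈ₙ v 0 ∧ z = sing a)
    (SP.exists 0 ((ST.mem 0 ST.last (ST.var' 0 rfl).weak.weak).and
      (ST.eq 1 ST.last.weak ST.last.sing))) ![A] z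

theorem mem_prod (A B p : M) : p ∈ₙ prod A B ↔ ∃ a, a ∈ₙ A ∧ ∃ b, b ∈ₙ B ∧ p = pair a b :=
  mem_setOf (σ := ![5, 5]) (k := 4)
    (P := fun v p => ∃ a, a ∈ₙ v 0 ∧ ∃ b, b ∈ₙ v 1 ∧ p = pair a b)
    (SP.exists 4 ((ST.mem 4 ST.last (ST.var' 0 rfl).weak.weak).and
      (SP.exists 4 ((ST.mem 4 ST.last (ST.var' 1 rfl).weak.weak.weak).and
        (ST.eq 4 ST.last.weak.weak (ST.last.weak.pair ST.last)))))) ![A, B] p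

theorem pair_mem_prod (h : QuinePairing M) (A B a b : M) :
    pair a b ∈ₙ prod A B ↔ a ∈ₙ A ∧ b ∈ₙ B := by
  rw [mem_prod]
  constructor
  · rintro ⟨a', ha, b', hb, e⟩
    obtain ⟨rfl, rfl⟩ := h _ _ _ _ e
    exact ⟨ha, hb⟩
  · exact fun hab => ⟨a, hab.1, b, hab.2, rfl⟩

theorem mem_funSet (A B f : M) : f ∈ₙ funSet A B ↔ IsFun A B f := by
  refine mem_setOf (σ := ![5, 5]) (k := 5) (P := fun v f => IsFun (v 0) (v 1) f)
    (SP.and ?_ ?_) ![A, B] f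
  · refine SP.forall 4 ((ST.mem 4 ST.last ST.last.weak).imp ?_)
    exact SP.exists 4 ((ST.mem 4 ST.last (ST.var' 0 rfl).weak.weak.weak).and
      (SP.exists 4 ((ST.mem 4 ST.last (ST.var' 1 rfl).weak.weak.weak.weak).and
        (ST.eq 4 ST.last.weak.weak (ST.last.weak.pair ST.last)))))
  · refine SP.forall 4 ((ST.mem 4 ST.last (ST.var' 0 rfl).weak.weak).imp ?_)
    refine SP.exists 4 (SP.and ?_ ?_)
    · exact ST.pair_mem (k := 0) ST.last.weak ST.last ST.last.weak.weak
    · exact SP.forall 4 ((ST.pair_mem (k := 0) ST.last.weak.weak ST.last ST.last.weak.weak.weak).imp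
        (ST.eq 4 ST.last ST.last.weak))

theorem ST.compSet (hs : ST σ (k + 5) s) (ht : ST σ (k + 5) t) :
    ST σ (k + 5) (fun v => compSet (s v) (t v)) :=
  ST.graph (SP.exists (k + 4) ((ST.pair_mem ST.last.weak.weak ST.last hs.weak.weak.weak).and
    (ST.pair_mem ST.last ST.last.weak ht.weak.weak.weak)))

theorem isGraph_comp (f g : M) : IsGraph fun a c => ∃ b, pair a b ∈ₙ f ∧ pair b c ∈ₙ g :=
  isGraph (σ := ![5, 5]) (k := 0) (R := fun v a c => ∃ b, pair a b ∈ₙ v 0 ∧ pair b c ∈ₙ v 1)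
    (SP.exists 4 ((ST.pair_mem ST.last.weak.weak ST.last (ST.var' 0 rfl).weak.weak.weak).and
      (ST.pair_mem ST.last ST.last.weak (ST.var' 1 rfl).weak.weak.weak))) ![f, g]

theorem isFun_comp (h : QuinePairing M) {A B C f g : M} (hf : IsFun A B f) (hg : IsFun B C g) :
    IsFun A C (compSet f g) := by
  refine (isGraph_comp f g).isFun h ?_ ?_ ?_
  · rintro a c ⟨b, hab, hbc⟩
    exact ⟨(hf.dom h hab).1, (hg.dom h hbc).2⟩
  · intro a ha
    obtain ⟨b, hb, -⟩ := hf.2 a ha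
    obtain ⟨c, hc, -⟩ := hg.2 b (hf.dom h hb).2
    exact ⟨c, b, hb, hc⟩
  · rintro a c c' ⟨b, hab, hbc⟩ ⟨b', hab', hbc'⟩
    obtain rfl := hf.uniq h hab hab'
    exact hg.uniq h hbc hbc'

theorem pair_mem_compSet (h : QuinePairing M) (f g a c : M) :
    pair a c ∈ₙ compSet f g ↔ ∃ b, pair a b ∈ₙ f ∧ pair b c ∈ₙ g :=
  (isGraph_comp f g).pair_mem h

end Functions

/-! ## Relative adjunctions and pseudo-cartesian closed categories -/

section Relative

variable {C : Type u₁} {D : Type u₂} {E : Type u₃} [Category.{v₁} C] [Category.{v₂} D]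
  [Category.{v₃} E]

/-- `F` is a `J`-left adjoint to `G`, written `F _J⊣ G`: a bijection, natural in `X` and `Y`, between
the arrows `F X ⟶ Y` and the arrows `J X ⟶ G Y`. -/
structure LeftRelAdj (F : E ⥤ C) (J : E ⥤ D) (G : C ⥤ D) where
  homEquiv (X : E) (Y : C) : (F.obj X ⟶ Y) ≃ (J.obj X ⟶ G.obj Y)
  naturality_left {X' X : E} {Y : C} (f : X' ⟶ X) (g : F.obj X ⟶ Y) :
    homEquiv X' Y (F.map f ≫ g) = J.map f ≫ homEquiv X Y g
  naturality_right {X : E} {Y Y' : C} (g : F.obj X ⟶ Y) (h : Y ⟶ Y') :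
    homEquiv X Y' (g ≫ h) = homEquiv X Y g ≫ G.map h

/-- `F` is a `J`-right adjoint to `G`, written `G ⊣_J F`: a bijection, natural in `Y` and `X`, between
the arrows `Y ⟶ F X` and the arrows `G Y ⟶ J X`. -/
structure RightRelAdj (G : C ⥤ D) (J : E ⥤ D) (F : E ⥤ C) where
  homEquiv (Y : C) (X : E) : (Y ⟶ F.obj X) ≃ (G.obj Y ⟶ J.obj X)
  naturality_left {Y' Y : C} {X : E} (f : Y' ⟶ Y) (g : Y ⟶ F.obj X) :
    homEquiv Y' X (f ≫ g) = G.map f ≫ homEquiv Y X g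
  naturality_right {Y : C} {X X' : E} (g : Y ⟶ F.obj X) (h : X ⟶ X') :
    homEquiv Y X' (g ≫ F.map h) = homEquiv Y X g ≫ J.map h

/-- The component `G (F X) ⟶ J X` at `X` of the counit of `G ⊣_J F`. -/
def RightRelAdj.counit {G : C ⥤ D} {J : E ⥤ D} {F : E ⥤ C} (adj : RightRelAdj G J F) (X : E) :
    G.obj (F.obj X) ⟶ J.obj X :=
  adj.homEquiv (F.obj X) X (𝟙 (F.obj X))

/-- A category with finite products is pseudo-cartesian closed with respect to an endofunctor `T` if
for every object `A` there is a functor `A ⇒ -` with `(TA × -) ⊣_T (A ⇒ -)` and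
`(A × -) _T⊣ (A ⇒ -)`. -/
def PseudoCartesianClosed (C : Type u₁) [Category.{v₁} C] [CartesianMonoidalCategory C]
    (T : C ⥤ C) : Prop :=
  ∀ A : C, ∃ H : C ⥤ C, Nonempty (RightRelAdj (tensorLeft (T.obj A)) T H) ∧
    Nonempty (LeftRelAdj (tensorLeft A) T H)

end Relative

/-! ## The category of NF sets -/

section Cat

variable {M : Type u} [setLang.Structure M] [NFModel M]

/-- The objects of the category of NF sets: the elements of the model. The argument records that
Quine's pairs are ordered pairs, so that functions can be composed. -/
@[ext]
structure NSet (h : QuinePairing M) where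
  set : M

variable {h : QuinePairing M}

/-- The arrows `A ⟶ B` of the category of NF sets: the functions from `A` to `B` in the model. -/
@[ext]
structure NHom (A B : NSet h) where
  graph : M
  isFun : IsFun A.set B.set graph

/-- The arrow given by a relation that is a set, is contained in `A × B`, and is functional. -/
noncomputable def NHom.ofRel {A B : NSet h} (R : M → M → Prop) (hR : IsGraph R)
    (hAB : ∀ a b, R a b → a ∈ₙ A.set ∧ b ∈ₙ B.set) (hex : ∀ a, a ∈ₙ A.set → ∃ b, R a b)
    (huniq : ∀ a b b', R a b → R a b' → b = b') : NHom A B :=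
  ⟨NF.graph R, hR.isFun h hAB hex huniq⟩

theorem NHom.pair_mem_ofRel {A B : NSet h} {R : M → M → Prop} (hR : IsGraph R)
    (hAB : ∀ a b, R a b → a ∈ₙ A.set ∧ b ∈ₙ B.set) (hex : ∀ a, a ∈ₙ A.set → ∃ b, R a b)
    (huniq : ∀ a b b', R a b → R a b' → b = b') (a b : M) :
    pair a b ∈ₙ (NHom.ofRel (A := A) (B := B) R hR hAB hex huniq).graph ↔ R a b :=
  hR.pair_mem h

theorem NHom.ext_pair {A B : NSet h} {f g : NHom A B}
    (hfg : ∀ a b, pair a b ∈ₙ f.graph ↔ pair a b ∈ₙ g.graph) : f = g :=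
  NHom.ext (f.isFun.ext g.isFun hfg)

theorem isGraph_id (A : M) : IsGraph fun a b => a ∈ₙ A ∧ b = a :=
  isGraph (σ := ![5]) (k := 0) (R := fun v a b => a ∈ₙ v 0 ∧ b = a)
    ((ST.mem 4 ST.last.weak (ST.var' 0 rfl).weak.weak).and (ST.eq 4 ST.last ST.last.weak)) ![A]

noncomputable instance : Category (NSet h) where
  Hom A B := NHom A B
  id A := NHom.ofRel (fun a b => a ∈ₙ A.set ∧ b = a) (isGraph_id A.set)
    (by rintro a b ⟨ha, rfl⟩; exact ⟨ha, ha⟩) (fun a ha => ⟨a, ha, rfl⟩)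
    (by rintro a b b' ⟨_, rfl⟩ ⟨_, rfl⟩; rfl)
  comp f g := ⟨compSet f.graph g.graph, isFun_comp h f.isFun g.isFun⟩
  id_comp {A B} f := NHom.ext_pair fun a b => by
    simp only [pair_mem_compSet h, NHom.ofRel, (isGraph_id A.set).pair_mem h]
    constructor
    · rintro ⟨c, ⟨_, rfl⟩, hc⟩
      exact hc
    · exact fun hab => ⟨a, ⟨(f.isFun.dom h hab).1, rfl⟩, hab⟩
  comp_id {A B} f := NHom.ext_pair fun a b => by
    simp only [pair_mem_compSet h, NHom.ofRel, (isGraph_id B.set).pair_mem h]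
    constructor
    · rintro ⟨c, hc, ⟨_, rfl⟩⟩
      exact hc
    · exact fun hab => ⟨b, hab, (f.isFun.dom h hab).2, rfl⟩
  assoc f g k := NHom.ext_pair fun a b => by
    simp only [pair_mem_compSet h]
    constructor
    · rintro ⟨c, ⟨d, h₁, h₂⟩, h₃⟩
      exact ⟨d, h₁, c, h₂, h₃⟩
    · rintro ⟨d, h₁, c, h₂, h₃⟩
      exact ⟨c, ⟨d, h₁, h₂⟩, h₃⟩

theorem hom_ext {A B : NSet h} {f g : A ⟶ B}
    (hfg : ∀ a b, pair a b ∈ₙ NHom.graph f ↔ pair a b ∈ₙ NHom.graph g) : f = g :=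
  NHom.ext_pair hfg

theorem pair_mem_id (A : NSet h) (a b : M) :
    pair a b ∈ₙ NHom.graph (𝟙 A) ↔ a ∈ₙ A.set ∧ b = a :=
  (isGraph_id A.set).pair_mem h

theorem pair_mem_comp {A B C : NSet h} (f : A ⟶ B) (g : B ⟶ C) (a c : M) :
    pair a c ∈ₙ NHom.graph (f ≫ g) ↔ ∃ b, pair a b ∈ₙ NHom.graph f ∧ pair b c ∈ₙ NHom.graph g :=
  pair_mem_compSet h _ _ a c

theorem isGraph_T (f : M) : IsGraph fun x y => ∃ a b, pair a b ∈ₙ f ∧ x = sing a ∧ y = sing b := by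
  refine isGraph (σ := ![5]) (k := 1)
    (R := fun v x y => ∃ a b, pair a b ∈ₙ v 0 ∧ x = sing a ∧ y = sing b) ?_ ![f]
  refine SP.exists 4 (SP.exists (P := fun w b => pair (w (Fin.last 3)) b ∈ₙ
    (Fin.init (Fin.init (Fin.init w : Fin 3 → M) : Fin 2 → M) : Fin 1 → M) 0 ∧
    (Fin.init (Fin.init w : Fin 3 → M) : Fin 2 → M) (Fin.last 1) = sing (w (Fin.last 3)) ∧
    (Fin.init w : Fin 3 → M) (Fin.last 2) = sing b) 4 ?_)
  exact (ST.pair_mem (k := 0) ST.last.weak ST.last (ST.var' 0 rfl).weak.weak.weak.weak).and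
    ((ST.eq 5 ST.last.weak.weak.weak ST.last.weak.sing).and
      (ST.eq 5 ST.last.weak.weak ST.last.sing))

/-- The functor `T`: it takes `A` to `ι‘‘A`, and `f` to the function `{a} ↦ {f(a)}`. -/
noncomputable def T : NSet h ⥤ NSet h where
  obj A := ⟨singImage A.set⟩
  map {A B} f := NHom.ofRel
    (fun x y => ∃ a b, pair a b ∈ₙ NHom.graph f ∧ x = sing a ∧ y = sing b) (isGraph_T _)
    (by
      rintro _ _ ⟨a, b, hab, rfl, rfl⟩
      have := (NHom.isFun f).dom h hab
      exact ⟨(mem_singImage _ _).mpr ⟨a, this.1, rfl⟩, (mem_singImage _ _).mpr ⟨b, this.2, rfl⟩⟩)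
    (by
      intro x hx
      obtain ⟨a, ha, rfl⟩ := (mem_singImage _ _).mp hx
      obtain ⟨b, hb, -⟩ := (NHom.isFun f).2 a ha
      exact ⟨sing b, a, b, hb, rfl, rfl⟩)
    (by
      rintro _ _ _ ⟨a, b, hab, rfl, rfl⟩ ⟨a', b', hab', e, rfl⟩
      obtain rfl := sing_inj e
      rw [(NHom.isFun f).uniq h hab hab'])
  map_id A := hom_ext fun x y => by
    refine (NHom.pair_mem_ofRel ..).trans (Iff.trans ?_ (pair_mem_id _ x y).symm)
    rw [mem_singImage]
    constructor
    · rintro ⟨a, b, hab, rfl, rfl⟩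
      obtain ⟨ha, rfl⟩ := (pair_mem_id _ _ _).mp hab
      exact ⟨⟨_, ha, rfl⟩, rfl⟩
    · rintro ⟨⟨a, ha, rfl⟩, rfl⟩
      exact ⟨a, a, (pair_mem_id _ _ _).mpr ⟨ha, rfl⟩, rfl, rfl⟩
  map_comp {A B C} f g := hom_ext fun x y => by
    refine (NHom.pair_mem_ofRel ..).trans (Iff.trans ?_ (pair_mem_comp _ _ x y).symm)
    constructor
    · rintro ⟨a, c, hac, rfl, rfl⟩
      obtain ⟨b, hab, hbc⟩ := (pair_mem_comp _ _ _ _).mp hac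
      exact ⟨sing b, (NHom.pair_mem_ofRel ..).mpr ⟨a, b, hab, rfl, rfl⟩,
        (NHom.pair_mem_ofRel ..).mpr ⟨b, c, hbc, rfl, rfl⟩⟩
    · rintro ⟨z, h₁, h₂⟩
      obtain ⟨a, b, hab, rfl, rfl⟩ := (NHom.pair_mem_ofRel ..).mp h₁
      obtain ⟨b', c, hbc, e, rfl⟩ := (NHom.pair_mem_ofRel ..).mp h₂
      obtain rfl := sing_inj e
      exact ⟨a, c, (pair_mem_comp _ _ _ _).mpr ⟨b, hab, hbc⟩, rfl, rfl⟩

/-! ### Finite products -/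

theorem isGraph_toOne (A : M) : IsGraph fun a b => a ∈ₙ A ∧ b = empty M :=
  isGraph (σ := ![5]) (k := 0) (R := fun v a b => a ∈ₙ v 0 ∧ b = empty M)
    ((ST.mem 4 ST.last.weak (ST.var' 0 rfl).weak.weak).and (ST.eq 4 ST.last ST.empty)) ![A]

/-- The terminal object `{∅}`. -/
noncomputable def one (h : QuinePairing M) : NSet h := ⟨sing (empty M)⟩

/-- The function from `A` to `{∅}`. -/
noncomputable def toOne (A : NSet h) : A ⟶ one h :=
  NHom.ofRel (fun a b => a ∈ₙ A.set ∧ b = empty M) (isGraph_toOne A.set)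
    (by rintro a b ⟨ha, rfl⟩; exact ⟨ha, (mem_sing _ _).mpr rfl⟩) (fun a ha => ⟨_, ha, rfl⟩)
    (by rintro a b b' ⟨_, rfl⟩ ⟨_, rfl⟩; rfl)

theorem hom_one_ext {A : NSet h} (f g : A ⟶ one h) : f = g := by
  have key : ∀ f g : A ⟶ one h, ∀ a b, pair a b ∈ₙ NHom.graph f → pair a b ∈ₙ NHom.graph g := by
    intro f g a b hab
    obtain ⟨ha, hb⟩ := (NHom.isFun f).dom h hab
    obtain ⟨b', hb', -⟩ := (NHom.isFun g).2 a ha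
    have e := (mem_sing _ _).mp ((NHom.isFun g).dom h hb').2
    rw [(mem_sing _ _).mp hb, ← e]
    exact hb'
  exact hom_ext fun a b => ⟨key f g a b, key g f a b⟩

/-- The object `A × B`. -/
noncomputable def prodObj (A B : NSet h) : NSet h := ⟨prod A.set B.set⟩

theorem isGraph_fst (A B : M) : IsGraph fun p a => a ∈ₙ A ∧ ∃ b, b ∈ₙ B ∧ p = pair a b :=
  isGraph (σ := ![5, 5]) (k := 0) (R := fun v p a => a ∈ₙ v 0 ∧ ∃ b, b ∈ₙ v 1 ∧ p = pair a b)
    ((ST.mem 4 ST.last (ST.var' 0 rfl).weak.weak).and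
      (SP.exists 4 ((ST.mem 4 ST.last (ST.var' 1 rfl).weak.weak.weak).and
        (ST.eq 4 ST.last.weak.weak (ST.pair ST.last.weak ST.last))))) ![A, B]

theorem isGraph_snd (A B : M) : IsGraph fun p b => b ∈ₙ B ∧ ∃ a, a ∈ₙ A ∧ p = pair a b :=
  isGraph (σ := ![5, 5]) (k := 0) (R := fun v p b => b ∈ₙ v 1 ∧ ∃ a, a ∈ₙ v 0 ∧ p = pair a b)
    ((ST.mem 4 ST.last (ST.var' 1 rfl).weak.weak).and
      (SP.exists 4 ((ST.mem 4 ST.last (ST.var' 0 rfl).weak.weak.weak).and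
        (ST.eq 4 ST.last.weak.weak (ST.pair ST.last ST.last.weak))))) ![A, B]

theorem isGraph_lift (f g : M) :
    IsGraph fun c p => ∃ a b, pair c a ∈ₙ f ∧ pair c b ∈ₙ g ∧ p = pair a b := by
  refine isGraph (σ := ![5, 5]) (k := 0)
    (R := fun v c p => ∃ a b, pair c a ∈ₙ v 0 ∧ pair c b ∈ₙ v 1 ∧ p = pair a b) ?_ ![f, g]
  refine SP.exists 4 (SP.exists (P := fun w b =>
    pair ((Fin.init (Fin.init w : Fin 4 → M) : Fin 3 → M) (Fin.last 2)) (w (Fin.last 4)) ∈ₙ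
      (Fin.init (Fin.init (Fin.init w : Fin 4 → M) : Fin 3 → M) : Fin 2 → M) 0 ∧
    pair ((Fin.init (Fin.init w : Fin 4 → M) : Fin 3 → M) (Fin.last 2)) b ∈ₙ
      (Fin.init (Fin.init (Fin.init w : Fin 4 → M) : Fin 3 → M) : Fin 2 → M) 1 ∧
    (Fin.init w : Fin 4 → M) (Fin.last 3) = pair (w (Fin.last 4)) b) 4 ?_)
  exact (ST.pair_mem (k := 0) ST.last.weak.weak.weak ST.last.weak
      (ST.var' 0 rfl).weak.weak.weak.weak).and
    ((ST.pair_mem (k := 0) ST.last.weak.weak.weak ST.last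
      (ST.var' 1 rfl).weak.weak.weak.weak).and
      (ST.eq 4 ST.last.weak.weak (ST.pair ST.last.weak ST.last)))

/-- The projection `⟨a, b⟩ ↦ a`. -/
noncomputable def prodFst (A B : NSet h) : prodObj A B ⟶ A :=
  NHom.ofRel (fun p a => a ∈ₙ A.set ∧ ∃ b, b ∈ₙ B.set ∧ p = pair a b) (isGraph_fst _ _)
    (by rintro _ a ⟨ha, b, hb, rfl⟩; exact ⟨(pair_mem_prod h _ _ _ _).mpr ⟨ha, hb⟩, ha⟩)
    (by
      intro p hp
      obtain ⟨a, ha, b, hb, rfl⟩ := (mem_prod _ _ _).mp hp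
      exact ⟨a, ha, b, hb, rfl⟩)
    (by rintro _ a a' ⟨_, b, _, rfl⟩ ⟨_, b', _, e⟩; exact (h _ _ _ _ e).1)

/-- The projection `⟨a, b⟩ ↦ b`. -/
noncomputable def prodSnd (A B : NSet h) : prodObj A B ⟶ B :=
  NHom.ofRel (fun p b => b ∈ₙ B.set ∧ ∃ a, a ∈ₙ A.set ∧ p = pair a b) (isGraph_snd _ _)
    (by rintro _ b ⟨hb, a, ha, rfl⟩; exact ⟨(pair_mem_prod h _ _ _ _).mpr ⟨ha, hb⟩, hb⟩)
    (by
      intro p hp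
      obtain ⟨a, ha, b, hb, rfl⟩ := (mem_prod _ _ _).mp hp
      exact ⟨b, hb, a, ha, rfl⟩)
    (by rintro _ b b' ⟨_, a, _, rfl⟩ ⟨_, a', _, e⟩; exact (h _ _ _ _ e).2)

/-- The function `c ↦ ⟨f(c), g(c)⟩`. -/
noncomputable def prodLift {A B C : NSet h} (f : C ⟶ A) (g : C ⟶ B) : C ⟶ prodObj A B :=
  NHom.ofRel
    (fun c p => ∃ a b, pair c a ∈ₙ NHom.graph f ∧ pair c b ∈ₙ NHom.graph g ∧ p = pair a b)
    (isGraph_lift _ _)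
    (by
      rintro c _ ⟨a, b, ha, hb, rfl⟩
      exact ⟨((NHom.isFun f).dom h ha).1, (pair_mem_prod h _ _ _ _).mpr
        ⟨((NHom.isFun f).dom h ha).2, ((NHom.isFun g).dom h hb).2⟩⟩)
    (by
      intro c hc
      obtain ⟨a, ha, -⟩ := (NHom.isFun f).2 c hc
      obtain ⟨b, hb, -⟩ := (NHom.isFun g).2 c hc
      exact ⟨_, a, b, ha, hb, rfl⟩)
    (by
      rintro c _ _ ⟨a, b, ha, hb, rfl⟩ ⟨a', b', ha', hb', rfl⟩
      rw [(NHom.isFun f).uniq h ha ha', (NHom.isFun g).uniq h hb hb'])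

theorem pair_mem_fst (A B : NSet h) (a b x : M) :
    pair (pair a b) x ∈ₙ NHom.graph (prodFst A B) ↔ a ∈ₙ A.set ∧ b ∈ₙ B.set ∧ x = a := by
  refine (NHom.pair_mem_ofRel ..).trans ⟨?_, ?_⟩
  · rintro ⟨ha, b', hb, e⟩
    obtain ⟨rfl, rfl⟩ := h _ _ _ _ e
    exact ⟨ha, hb, rfl⟩
  · rintro ⟨ha, hb, rfl⟩
    exact ⟨ha, b, hb, rfl⟩

theorem pair_mem_snd (A B : NSet h) (a b x : M) :
    pair (pair a b) x ∈ₙ NHom.graph (prodSnd A B) ↔ a ∈ₙ A.set ∧ b ∈ₙ B.set ∧ x = b := by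
  refine (NHom.pair_mem_ofRel ..).trans ⟨?_, ?_⟩
  · rintro ⟨hb, a', ha, e⟩
    obtain ⟨rfl, rfl⟩ := h _ _ _ _ e
    exact ⟨ha, hb, rfl⟩
  · rintro ⟨ha, hb, rfl⟩
    exact ⟨hb, a, ha, rfl⟩

theorem pair_mem_lift {A B C : NSet h} (f : C ⟶ A) (g : C ⟶ B) (c a b : M) :
    pair c (pair a b) ∈ₙ NHom.graph (prodLift f g) ↔
      pair c a ∈ₙ NHom.graph f ∧ pair c b ∈ₙ NHom.graph g := by
  refine (NHom.pair_mem_ofRel ..).trans ⟨?_, fun H => ⟨a, b, H.1, H.2, rfl⟩⟩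
  rintro ⟨a', b', ha, hb, e⟩
  obtain ⟨rfl, rfl⟩ := h _ _ _ _ e
  exact ⟨ha, hb⟩

theorem pair_mem_comp_fst {A B C : NSet h} (m : C ⟶ prodObj A B) (c a : M) :
    pair c a ∈ₙ NHom.graph (m ≫ prodFst A B) ↔ ∃ b, pair c (pair a b) ∈ₙ NHom.graph m := by
  rw [pair_mem_comp]
  constructor
  · rintro ⟨p, hp, hpa⟩
    obtain ⟨a', _, b, _, rfl⟩ := (mem_prod _ _ _).mp ((NHom.isFun m).dom h hp).2
    obtain ⟨_, _, rfl⟩ := (pair_mem_fst _ _ _ _ _).mp hpa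
    exact ⟨b, hp⟩
  · rintro ⟨b, hb⟩
    have := (pair_mem_prod h _ _ _ _).mp ((NHom.isFun m).dom h hb).2
    exact ⟨_, hb, (pair_mem_fst _ _ _ _ _).mpr ⟨this.1, this.2, rfl⟩⟩

theorem pair_mem_comp_snd {A B C : NSet h} (m : C ⟶ prodObj A B) (c b : M) :
    pair c b ∈ₙ NHom.graph (m ≫ prodSnd A B) ↔ ∃ a, pair c (pair a b) ∈ₙ NHom.graph m := by
  rw [pair_mem_comp]
  constructor
  · rintro ⟨p, hp, hpa⟩
    obtain ⟨a, _, b', _, rfl⟩ := (mem_prod _ _ _).mp ((NHom.isFun m).dom h hp).2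
    obtain ⟨_, _, rfl⟩ := (pair_mem_snd _ _ _ _ _).mp hpa
    exact ⟨a, hp⟩
  · rintro ⟨a, ha⟩
    have := (pair_mem_prod h _ _ _ _).mp ((NHom.isFun m).dom h ha).2
    exact ⟨_, ha, (pair_mem_snd _ _ _ _ _).mpr ⟨this.1, this.2, rfl⟩⟩

theorem lift_fst {A B C : NSet h} (f : C ⟶ A) (g : C ⟶ B) : prodLift f g ≫ prodFst A B = f := by
  refine hom_ext fun c a => ?_
  simp only [pair_mem_comp_fst, pair_mem_lift]
  constructor
  · rintro ⟨b, ha, _⟩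
    exact ha
  · intro ha
    obtain ⟨b, hb, -⟩ := (NHom.isFun g).2 c ((NHom.isFun f).dom h ha).1
    exact ⟨b, ha, hb⟩

theorem lift_snd {A B C : NSet h} (f : C ⟶ A) (g : C ⟶ B) : prodLift f g ≫ prodSnd A B = g := by
  refine hom_ext fun c b => ?_
  simp only [pair_mem_comp_snd, pair_mem_lift]
  constructor
  · rintro ⟨a, _, hb⟩
    exact hb
  · intro hb
    obtain ⟨a, ha, -⟩ := (NHom.isFun f).2 c ((NHom.isFun g).dom h hb).1
    exact ⟨a, ha, hb⟩

theorem eq_lift {A B C : NSet h} (f : C ⟶ A) (g : C ⟶ B) (m : C ⟶ prodObj A B)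
    (hf : m ≫ prodFst A B = f) (hg : m ≫ prodSnd A B = g) : m = prodLift f g := by
  subst hf hg
  have key : ∀ c p, pair c p ∈ₙ NHom.graph m →
      pair c p ∈ₙ NHom.graph (prodLift (m ≫ prodFst A B) (m ≫ prodSnd A B)) := by
    intro c p hp
    obtain ⟨a, _, b, _, rfl⟩ := (mem_prod _ _ _).mp ((NHom.isFun m).dom h hp).2
    rw [pair_mem_lift, pair_mem_comp_fst, pair_mem_comp_snd]
    exact ⟨⟨b, hp⟩, ⟨a, hp⟩⟩
  refine hom_ext fun c p => ⟨key c p, fun hp => ?_⟩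
  obtain ⟨q, hq, -⟩ := (NHom.isFun m).2 c ((NHom.isFun (prodLift _ _)).dom h hp).1
  rw [(NHom.isFun (prodLift _ _)).uniq h hp (key c q hq)]
  exact hq

/-- The finite products of the category of NF sets: `A ⊗ B` is the set `A × B` with its two
projections, and the unit is `{∅}`. -/
noncomputable instance : CartesianMonoidalCategory (NSet h) :=
  .ofChosenFiniteProducts
    ⟨asEmptyCone (one h), IsTerminal.ofUniqueHom toOne fun _ _ => hom_one_ext _ _⟩
    fun A B => ⟨BinaryFan.mk (prodFst A B) (prodSnd A B),
      BinaryFan.IsLimit.mk _ prodLift lift_fst lift_snd eq_lift⟩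

/-! ### Function sets and pseudo-evaluation -/

theorem isGraph_postcomp (F g : M) : IsGraph fun f f' => f ∈ₙ F ∧ f' = compSet f g :=
  isGraph (σ := ![6, 5]) (k := 1) (R := fun v f f' => f ∈ₙ v 0 ∧ f' = compSet f (v 1))
    ((ST.mem 5 ST.last.weak (ST.var' 0 rfl).weak.weak).and
      (ST.eq 5 ST.last (ST.compSet (k := 0) ST.last.weak (ST.var' 1 rfl).weak.weak))) ![F, g]

/-- The functor `A ⇒ -`: it takes `B` to the set of functions from `A` to `B`, and `g` to the
function `f ↦ g ∘ f`. -/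
noncomputable def funFunctor (A : NSet h) : NSet h ⥤ NSet h where
  obj B := ⟨funSet A.set B.set⟩
  map {B C} g := NHom.ofRel
    (fun f f' => f ∈ₙ funSet A.set B.set ∧ f' = compSet f (NHom.graph g)) (isGraph_postcomp _ _)
    (by
      rintro f _ ⟨hf, rfl⟩
      exact ⟨hf, (mem_funSet _ _ _).mpr (isFun_comp h ((mem_funSet _ _ _).mp hf) (NHom.isFun g))⟩)
    (fun f hf => ⟨_, hf, rfl⟩)
    (by rintro f _ _ ⟨_, rfl⟩ ⟨_, rfl⟩; rfl)
  map_id B := hom_ext fun f f' => by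
    refine (NHom.pair_mem_ofRel ..).trans (Iff.trans ?_ (pair_mem_id _ f f').symm)
    refine and_congr_right fun hf => ?_
    have e : compSet f (NHom.graph (𝟙 B)) = f :=
      congrArg (fun k : A ⟶ B => NHom.graph k)
        (Category.comp_id (X := A) (Y := B) (⟨f, (mem_funSet _ _ _).mp hf⟩ : NHom A B))
    rw [e]
  map_comp {B C D} g k := hom_ext fun f f' => by
    refine (NHom.pair_mem_ofRel ..).trans (Iff.trans ?_ (pair_mem_comp _ _ f f').symm)
    have e : ∀ f, f ∈ₙ funSet A.set B.set →
        compSet f (NHom.graph (g ≫ k)) = compSet (compSet f (NHom.graph g)) (NHom.graph k) :=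
      fun f hf => congrArg NHom.graph
        (Category.assoc (⟨f, (mem_funSet _ _ _).mp hf⟩ : NHom A B) g k).symm
    constructor
    · rintro ⟨hf, rfl⟩
      refine ⟨compSet f (NHom.graph g), (NHom.pair_mem_ofRel ..).mpr ⟨hf, rfl⟩,
        (NHom.pair_mem_ofRel ..).mpr ⟨?_, e f hf⟩⟩
      exact (mem_funSet _ _ _).mpr (isFun_comp h ((mem_funSet _ _ _).mp hf) (NHom.isFun g))
    · rintro ⟨_, h₁, h₂⟩
      obtain ⟨hf, rfl⟩ := (NHom.pair_mem_ofRel ..).mp h₁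
      obtain ⟨_, rfl⟩ := (NHom.pair_mem_ofRel ..).mp h₂
      exact ⟨hf, (e f hf).symm⟩

theorem isGraph_ev (F : M) : IsGraph fun p z =>
    ∃ f, f ∈ₙ F ∧ ∃ a b, pair a b ∈ₙ f ∧ p = pair (sing a) f ∧ z = sing b := by
  refine isGraph (σ := ![6]) (k := 1) (R := fun v p z =>
    ∃ f, f ∈ₙ v 0 ∧ ∃ a b, pair a b ∈ₙ f ∧ p = pair (sing a) f ∧ z = sing b) ?_ ![F]
  refine SP.exists 5 ((ST.mem 5 ST.last (ST.var' 0 rfl).weak.weak.weak).and (SP.exists 4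
    (SP.exists (P := fun w b => pair (w (Fin.last 4)) b ∈ₙ (Fin.init w : Fin 4 → M) (Fin.last 3) ∧
      (Fin.init (Fin.init (Fin.init w : Fin 4 → M) : Fin 3 → M) : Fin 2 → M) (Fin.last 1) =
        pair (sing (w (Fin.last 4))) ((Fin.init w : Fin 4 → M) (Fin.last 3)) ∧
      (Fin.init (Fin.init w : Fin 4 → M) : Fin 3 → M) (Fin.last 2) = sing b) 4 ?_)))
  exact (ST.pair_mem (k := 0) ST.last.weak ST.last ST.last.weak.weak).and
    ((ST.eq 5 ST.last.weak.weak.weak.weak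
      (ST.pair (k := 1) ST.last.weak.sing ST.last.weak.weak)).and
      (ST.eq 5 ST.last.weak.weak.weak ST.last.sing))

/-- The pseudo-evaluation `ev' : TA × (A ⇒ B) ⟶ TB`, the function `⟨{a}, f⟩ ↦ {f(a)}`. -/
noncomputable def ev (A B : NSet h) : T.obj A ⊗ (funFunctor A).obj B ⟶ T.obj B :=
  NHom.ofRel (A := prodObj (T.obj A) ((funFunctor A).obj B))
    (fun p z => ∃ f, f ∈ₙ funSet A.set B.set ∧
      ∃ a b, pair a b ∈ₙ f ∧ p = pair (sing a) f ∧ z = sing b)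
    (isGraph_ev _)
    (by
      rintro _ _ ⟨f, hf, a, b, hab, rfl, rfl⟩
      have := ((mem_funSet _ _ _).mp hf).dom h hab
      exact ⟨(pair_mem_prod h _ _ _ _).mpr ⟨(mem_singImage _ _).mpr ⟨a, this.1, rfl⟩, hf⟩,
        (mem_singImage _ _).mpr ⟨b, this.2, rfl⟩⟩)
    (by
      intro p hp
      obtain ⟨x, hx, f, hf, rfl⟩ := (mem_prod _ _ _).mp hp
      obtain ⟨a, ha, rfl⟩ := (mem_singImage _ _).mp hx
      obtain ⟨b, hb, -⟩ := ((mem_funSet _ _ _).mp hf).2 a ha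
      exact ⟨sing b, f, hf, a, b, hb, rfl, rfl⟩)
    (by
      rintro _ _ _ ⟨f, hf, a, b, hab, rfl, rfl⟩ ⟨f', hf', a', b', hab', e, rfl⟩
      obtain ⟨e₁, rfl⟩ := h _ _ _ _ e
      obtain rfl := sing_inj e₁
      rw [((mem_funSet _ _ _).mp hf).uniq h hab hab'])

end Cat
end NF

namespace NF

section Finite

variable {M : Type u} [setLang.Structure M] [NFModel M]
variable {n : ℕ} {σ : Fin n → ℕ} {k : ℕ} {s t : (Fin n → M) → M}

/-! ## Elementary sets and Kuratowski pairs -/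

/-! The proof has two independent halves: Quine's pair is an ordered pair in every model of NF,
which rests on the axiom of infinity, and function sets have the required universal properties,
which is a matter of counting types.

Infinity follows Specker's argument. Suppose every set is finite (`AllFinite`). Then no set is
equinumerous with a proper subset, cardinals are comparable (`AllFinite.embeds_total`), and
equinumerous power sets come from equinumerous sets (`AllFinite.equip_of_pow`). If `x` is
equinumerous with `pow y`, regard ι‘‘y as the base-two logarithm of `x`; it has the same type as
`x`, and its cardinality is determined by that of `x` and is smaller. So repeated logarithms stop,
and there is a set `S` of those `x` for which they stop after an even number of steps
(`AllFinite.exists_isColoring`). Taking logarithms commutes with x ↦ ι‘‘x, so `x` and ι‘‘x have the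
same parity. But the universe is its own power set, so ι‘‘V is the logarithm of V and has the
opposite parity. This contradiction is `not_allFinite`. Hence V lies in no Frege number, successor
is injective on numbers (`succ_inj`), the operation φ is injective and never produces a set
containing 0, and the marker 0 separates the two halves of a Quine pair (`quinePairing`).

For the second half, a Quine pair has the type of its components, so a function is one type above
its arguments and values. If g⟨{a}, c⟩ = {b}, then `a` and `b` are one type below `c`, the section
{⟨a, b⟩} has exactly the type of `c`, and c ↦ section is a set: this is `curry`, and it gives the
universal property of ev'. If instead g⟨a, c⟩ = b, the section is one type above `c`, hence level
with {c}, and {c} ↦ section is a set: this is `transpose`. These two operations are the bijections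
of the two relative adjunctions. -/

theorem mem_union (x y z : M) : z ∈ₙ union x y ↔ z ∈ₙ x ∨ z ∈ₙ y :=
  mem_setOf (σ := ![1, 1]) (k := 0) (P := fun v z => z ∈ₙ v 0 ∨ z ∈ₙ v 1)
    ((ST.mem 0 ST.last (ST.var' 0 rfl).weak).or (ST.mem 0 ST.last (ST.var' 1 rfl).weak)) ![x, y] z

/-- `x ∪ {a}`. -/
noncomputable def insert (x a : M) : M := union x (sing a)

/-- `x \ {a}`. -/
noncomputable def remove (x a : M) : M := setOf fun z => z ∈ₙ x ∧ ¬ z = a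

/-- The power set. -/
noncomputable def pow (x : M) : M := setOf fun s => ∀ z, z ∈ₙ s → z ∈ₙ x

variable (M) in
/-- The universal set. -/
noncomputable def univ : M := setOf fun _ => True

theorem mem_insert (x a z : M) : z ∈ₙ insert x a ↔ z ∈ₙ x ∨ z = a := by
  rw [insert, mem_union, mem_sing]

theorem mem_remove (x a z : M) : z ∈ₙ remove x a ↔ z ∈ₙ x ∧ ¬ z = a :=
  mem_setOf (σ := ![1, 0]) (k := 0) (P := fun v z => z ∈ₙ v 0 ∧ ¬ z = v 1)
    ((ST.mem 0 ST.last (ST.var' 0 rfl).weak).and (ST.eq 0 ST.last (ST.var' 1 rfl).weak).not)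
    ![x, a] z

theorem mem_pow (x s : M) : s ∈ₙ pow x ↔ ∀ z, z ∈ₙ s → z ∈ₙ x :=
  mem_setOf (σ := ![1]) (k := 1) (P := fun v s => ∀ z, z ∈ₙ s → z ∈ₙ v 0)
    (SP.forall 0 ((ST.mem 0 ST.last ST.last.weak).imp (ST.mem 0 ST.last (ST.var' 0 rfl).weak.weak)))
    ![x] s

theorem mem_univ (z : M) : z ∈ₙ univ M :=
  (mem_setOf (σ := (default : Fin 0 → ℕ)) (k := 0) (P := fun _ _ => True)
    ((SP.falsum _).not.congr fun _ => by simp) default z).mpr trivial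

theorem pow_univ : pow (univ M) = univ M :=
  NFModel.ext _ _ fun z => by simp [mem_pow, mem_univ]

theorem sing_mem_singImage (A a : M) : sing a ∈ₙ singImage A ↔ a ∈ₙ A := by
  rw [mem_singImage]
  constructor
  · rintro ⟨b, hb, e⟩
    rwa [sing_inj e]
  · exact fun ha => ⟨a, ha, rfl⟩

theorem ST.insert (hs : ST σ (k + 1) s) (ht : ST σ k t) :
    ST σ (k + 1) (fun v => insert (s v) (t v)) :=
  ST.union hs ht.sing

theorem ST.pow (h : ST σ (k + 1) t) : ST σ (k + 2) (fun v => pow (t v)) :=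
  ST.setOf (k := k + 1)
    (SP.forall k ((ST.mem k ST.last ST.last.weak).imp (ST.mem k ST.last h.weak.weak)))

theorem ST.singImage (h : ST σ (k + 1) t) : ST σ (k + 2) (fun v => singImage (t v)) :=
  ST.setOf (k := k + 1) (SP.exists k ((ST.mem k ST.last h.weak.weak).and
    (ST.eq (k + 1) ST.last.weak ST.last.sing)))

/-- The unordered pair `{a, b}`. -/
noncomputable def upair (a b : M) : M := insert (sing a) b

theorem mem_upair (a b z : M) : z ∈ₙ upair a b ↔ z = a ∨ z = b := by
  rw [upair, mem_insert, mem_sing]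

theorem upair_eq {a b c d : M} (e : upair a b = upair c d) :
    (a = c ∧ b = d) ∨ (a = d ∧ b = c) := by
  have h₁ := (mem_upair c d a).mp (e ▸ (mem_upair a b a).mpr (.inl rfl))
  have h₂ := (mem_upair c d b).mp (e ▸ (mem_upair a b b).mpr (.inr rfl))
  have h₃ := (mem_upair a b c).mp (e ▸ (mem_upair c d c).mpr (.inl rfl))
  have h₄ := (mem_upair a b d).mp (e ▸ (mem_upair c d d).mpr (.inr rfl))
  grind

/-- The Kuratowski pair `{{a}, {a, b}}`. -/
noncomputable def kpair (a b : M) : M := upair (upair a a) (upair a b)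

theorem kpair_inj {a b c d : M} (e : kpair a b = kpair c d) : a = c ∧ b = d := by
  rcases upair_eq e with ⟨e₁, e₂⟩ | ⟨e₁, e₂⟩ <;>
    rcases upair_eq e₁ with h | h <;> rcases upair_eq e₂ with h' | h' <;> grind

theorem ST.upair (hs : ST σ k s) (ht : ST σ k t) :
    ST σ (k + 1) (fun v => upair (s v) (t v)) := hs.sing.insert ht

theorem ST.kpair (hs : ST σ k s) (ht : ST σ k t) :
    ST σ (k + 2) (fun v => kpair (s v) (t v)) := (hs.upair hs).upair (hs.upair ht)

theorem ST.kpair_mem {u : (Fin n → M) → M} (hs : ST σ k s) (ht : ST σ k t)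
    (hu : ST σ (k + 3) u) : SP σ (fun v => NF.kpair (s v) (t v) ∈ₙ u v) :=
  ST.mem (k + 2) (hs.kpair ht) hu

/-- Kuratowski pairs are used for equinumerosity because Quine's are not yet known to be ordered
pairs. They sit two types above their components, which is harmless since both components have the
same type. -/
theorem exists_relation {R : (Fin n → M) → M → M → Prop}
    (h : SP (Fin.snoc (Fin.snoc σ k : Fin (n + 1) → ℕ) k : Fin (n + 2) → ℕ)
      (fun w => R (Fin.init (Fin.init w : Fin (n + 1) → M)) (Fin.init w (Fin.last n))
        (w (Fin.last (n + 1))))) (v : Fin n → M) :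
    ∃ f : M, ∀ a b, kpair a b ∈ₙ f ↔ R v a b := by
  have H : SP (Fin.snoc σ (k + 2) : Fin (n + 1) → ℕ)
      (fun w => ∃ a b, R (Fin.init w) a b ∧ w (Fin.last n) = kpair a b) := by
    refine SP.exists k (SP.exists (P := fun w b => R (Fin.init (Fin.init w : Fin (n + 1) → M))
      (w (Fin.last (n + 1))) b ∧ Fin.init w (Fin.last n) = kpair (w (Fin.last (n + 1))) b)
      k (SP.and ?_ ?_))
    -- The context is now parameters, pair, `a`, `b`; the renaming skips the pair, on which `R` does
    -- not depend.
    · have := h.rename (Fin.snoc (Fin.snoc (Fin.snoc σ (k + 2) : Fin (n + 1) → ℕ) k :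
        Fin (n + 2) → ℕ) k : Fin (n + 3) → ℕ)
        (Fin.snoc (Fin.snoc (fun i => i.castSucc.castSucc.castSucc) (Fin.last (n + 1)).castSucc :
          Fin (n + 1) → Fin (n + 3)) (Fin.last (n + 2)) : Fin (n + 2) → Fin (n + 3)) (by
          intro i
          refine Fin.lastCases ?_ (fun i => ?_) i
          · simp
          · refine Fin.lastCases ?_ (fun i => ?_) i <;> simp)
      refine this.congr fun v => iff_of_eq ?_
      refine _root_.congr (_root_.congr (congrArg R ?_) ?_) ?_
      · funext i
        simp [Fin.init]
      · simp [Fin.init]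
      · simp
    · exact ST.eq (k + 2) ST.last.weak.weak (ST.kpair ST.last.weak ST.last)
  refine ⟨setOf fun p => ∃ a b, R v a b ∧ p = kpair a b, fun a b => ?_⟩
  rw [mem_setOf (P := fun v p => ∃ a b, R v a b ∧ p = kpair a b) H v]
  constructor
  · rintro ⟨a', b', hab, e⟩
    obtain ⟨rfl, rfl⟩ := kpair_inj e
    exact hab
  · exact fun hab => ⟨a, b, hab, rfl⟩

/-! ## Equinumerosity -/

/-- `r` restricts to a bijection between the elements of `x` and those of `y`. -/
def IsBij (r : M → M → Prop) (x y : M) : Prop :=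
  (∀ a, a ∈ₙ x → ∃ b, b ∈ₙ y ∧ r a b) ∧ (∀ b, b ∈ₙ y → ∃ a, a ∈ₙ x ∧ r a b) ∧
    ∀ a, a ∈ₙ x → ∀ a', a' ∈ₙ x → ∀ b, b ∈ₙ y → ∀ b', b' ∈ₙ y →
      r a b → r a' b' → (a = a' ↔ b = b')

/-- `x` and `y` are equinumerous in the model. -/
def Equip (x y : M) : Prop := ∃ f, IsBij (fun a b => kpair a b ∈ₙ f) x y

theorem SP.equip (hs : ST σ (k + 1) s) (ht : ST σ (k + 1) t) :
    SP σ (fun v => Equip (s v) (t v)) := by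
  refine SP.exists (k + 3) (SP.and ?_ (SP.and ?_ ?_))
  · refine SP.forall k ((ST.mem k ST.last hs.weak.weak).imp ?_)
    refine SP.exists k ((ST.mem k ST.last ht.weak.weak.weak).and ?_)
    exact ST.kpair_mem ST.last.weak ST.last ST.last.weak.weak
  · refine SP.forall k ((ST.mem k ST.last ht.weak.weak).imp ?_)
    refine SP.exists k ((ST.mem k ST.last hs.weak.weak.weak).and ?_)
    exact ST.kpair_mem ST.last ST.last.weak ST.last.weak.weak
  · refine SP.forall k ((ST.mem k ST.last hs.weak.weak).imp ?_)
    refine SP.forall k ((ST.mem k ST.last hs.weak.weak.weak).imp ?_)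
    refine SP.forall k ((ST.mem k ST.last ht.weak.weak.weak.weak).imp ?_)
    refine SP.forall k ((ST.mem k ST.last ht.weak.weak.weak.weak.weak).imp ?_)
    refine SP.imp (ST.kpair_mem (k := k) ST.last.weak.weak.weak ST.last.weak
      ST.last.weak.weak.weak.weak) ?_
    refine SP.imp (ST.kpair_mem (k := k) ST.last.weak.weak ST.last
      ST.last.weak.weak.weak.weak) ?_
    exact (ST.eq k ST.last.weak.weak.weak ST.last.weak.weak).iff (ST.eq k ST.last.weak ST.last)

theorem Equip.of_relation {R : (Fin n → M) → M → M → Prop}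
    (h : SP (Fin.snoc (Fin.snoc σ k : Fin (n + 1) → ℕ) k : Fin (n + 2) → ℕ)
      (fun w => R (Fin.init (Fin.init w : Fin (n + 1) → M)) (Fin.init w (Fin.last n))
        (w (Fin.last (n + 1))))) (v : Fin n → M) {x y : M} (hR : IsBij (R v) x y) :
    Equip x y := by
  obtain ⟨f, hf⟩ := exists_relation h v
  refine ⟨f, ?_⟩
  have : (fun a b => kpair a b ∈ₙ f) = R v := by
    funext a b
    exact propext (hf a b)
  rwa [this]

theorem Equip.refl (x : M) : Equip x x :=
  .of_relation (σ := (default : Fin 0 → ℕ)) (k := 0) (R := fun _ a b => a = b)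
    (ST.eq 0 ST.last.weak ST.last) default
    ⟨fun a ha => ⟨a, ha, rfl⟩, fun a ha => ⟨a, ha, rfl⟩, by rintro a _ b _ _ _ _ _ rfl rfl; rfl⟩

theorem Equip.symm {x y : M} : Equip x y → Equip y x := by
  rintro ⟨f, h₁, h₂, h₃⟩
  refine .of_relation (σ := ![3]) (k := 0) (R := fun v a b => kpair b a ∈ₙ v 0)
    (ST.kpair_mem (k := 0) ST.last ST.last.weak (ST.var' 0 rfl).weak.weak) ![f] ⟨h₂, h₁, ?_⟩
  exact fun a ha a' ha' b hb b' hb' h h' => (h₃ b hb b' hb' a ha a' ha' h h').symm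

theorem Equip.trans {x y z : M} : Equip x y → Equip y z → Equip x z := by
  rintro ⟨f, h₁, h₂, h₃⟩ ⟨g, h₁', h₂', h₃'⟩
  refine .of_relation (σ := ![3, 3, 1]) (k := 0)
    (R := fun v a c => ∃ b, b ∈ₙ v 2 ∧ kpair a b ∈ₙ v 0 ∧ kpair b c ∈ₙ v 1) ?_ ![f, g, y]
    ⟨?_, ?_, ?_⟩
  · refine SP.exists 0 ((ST.mem 0 ST.last (ST.var' 2 rfl).weak.weak.weak).and (SP.and ?_ ?_))
    · exact ST.kpair_mem (k := 0) ST.last.weak.weak ST.last (ST.var' 0 rfl).weak.weak.weak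
    · exact ST.kpair_mem (k := 0) ST.last ST.last.weak (ST.var' 1 rfl).weak.weak.weak
  · intro a ha
    obtain ⟨b, hb, hab⟩ := h₁ a ha
    obtain ⟨c, hc, hbc⟩ := h₁' b hb
    exact ⟨c, hc, b, hb, hab, hbc⟩
  · intro c hc
    obtain ⟨b, hb, hbc⟩ := h₂' c hc
    obtain ⟨a, ha, hab⟩ := h₂ b hb
    exact ⟨a, ha, b, hb, hab, hbc⟩
  · rintro a ha a' ha' c hc c' hc' ⟨b, hb, hab, hbc⟩ ⟨b', hb', hab', hbc'⟩
    exact (h₃ a ha a' ha' b hb b' hb' hab hab').trans (h₃' b hb b' hb' c hc c' hc' hbc hbc')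

/-- `IsBij` ignores pairs outside the two sets, so the same `f` witnesses the restriction of the
bijection to `x'` and its image. -/
theorem Equip.restrict {x y x' : M} (h : Equip x y) (hx : ∀ z, z ∈ₙ x' → z ∈ₙ x) :
    ∃ y', (∀ z, z ∈ₙ y' → z ∈ₙ y) ∧ Equip x' y' := by
  obtain ⟨f, h₁, h₂, h₃⟩ := h
  have hS : ∀ b, b ∈ₙ setOf (fun b => b ∈ₙ y ∧ ∃ a, a ∈ₙ x' ∧ kpair a b ∈ₙ f) ↔
      b ∈ₙ y ∧ ∃ a, a ∈ₙ x' ∧ kpair a b ∈ₙ f :=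
    mem_setOf (σ := ![1, 1, 3]) (k := 0)
      (P := fun v b => b ∈ₙ v 0 ∧ ∃ a, a ∈ₙ v 1 ∧ kpair a b ∈ₙ v 2)
      ((ST.mem 0 ST.last (ST.var' 0 rfl).weak).and
        (SP.exists 0 ((ST.mem 0 ST.last (ST.var' 1 rfl).weak.weak).and
          (ST.kpair_mem (k := 0) ST.last ST.last.weak (ST.var' 2 rfl).weak.weak)))) ![y, x', f]
  refine ⟨_, fun z hz => ((hS z).mp hz).1, f, ?_, ?_, ?_⟩
  · intro a ha
    obtain ⟨b, hb, hab⟩ := h₁ a (hx a ha)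
    exact ⟨b, (hS b).mpr ⟨hb, a, ha, hab⟩, hab⟩
  · exact fun b hb => ((hS b).mp hb).2
  · exact fun a ha a' ha' b hb b' hb' =>
      h₃ a (hx a ha) a' (hx a' ha') b ((hS b).mp hb).1 b' ((hS b').mp hb').1

theorem Equip.insert {x y a b : M} (h : Equip x y) (ha : ¬ a ∈ₙ x) (hb : ¬ b ∈ₙ y) :
    Equip (insert x a) (insert y b) := by
  obtain ⟨f, h₁, h₂, h₃⟩ := h
  refine .of_relation (σ := ![1, 1, 3, 0, 0]) (k := 0)
    -- The guards are needed because `f` may contain arbitrary pairs outside `x` and `y`, in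
    -- particular pairs involving `a` or `b`.
    (R := fun v c d => (c ∈ₙ v 0 ∧ d ∈ₙ v 1 ∧ kpair c d ∈ₙ v 2) ∨ (c = v 3 ∧ d = v 4)) ?_
    ![x, y, f, a, b] ⟨?_, ?_, ?_⟩
  · refine SP.or (SP.and ?_ (SP.and ?_ ?_)) (SP.and ?_ ?_)
    · exact ST.mem 0 ST.last.weak (ST.var' 0 rfl).weak.weak
    · exact ST.mem 0 ST.last (ST.var' 1 rfl).weak.weak
    · exact ST.kpair_mem (k := 0) ST.last.weak ST.last (ST.var' 2 rfl).weak.weak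
    · exact ST.eq 0 ST.last.weak (ST.var' 3 rfl).weak.weak
    · exact ST.eq 0 ST.last (ST.var' 4 rfl).weak.weak
  · intro c hc
    rcases (mem_insert _ _ _).mp hc with hc | rfl
    · obtain ⟨d, hd, hcd⟩ := h₁ c hc
      exact ⟨d, (mem_insert _ _ _).mpr (.inl hd), .inl ⟨hc, hd, hcd⟩⟩
    · exact ⟨b, (mem_insert _ _ _).mpr (.inr rfl), .inr ⟨rfl, rfl⟩⟩
  · intro d hd
    rcases (mem_insert _ _ _).mp hd with hd | rfl
    · obtain ⟨c, hc, hcd⟩ := h₂ d hd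
      exact ⟨c, (mem_insert _ _ _).mpr (.inl hc), .inl ⟨hc, hd, hcd⟩⟩
    · exact ⟨a, (mem_insert _ _ _).mpr (.inr rfl), .inr ⟨rfl, rfl⟩⟩
  · rintro c - c' - d - d' - (⟨hc, hd, h⟩ | ⟨rfl, rfl⟩) (⟨hc', hd', h'⟩ | ⟨rfl, rfl⟩)
    · exact h₃ c hc c' hc' d hd d' hd' h h'
    · exact iff_of_false (fun e => ha (e ▸ hc)) (fun e => hb (e ▸ hd))
    · exact iff_of_false (fun e => ha (e ▸ hc')) (fun e => hb (e ▸ hd'))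
    · exact iff_of_true rfl rfl

theorem Equip.remove {x y a b : M} (h : Equip x y) (ha : a ∈ₙ x) (hb : b ∈ₙ y) :
    Equip (remove x a) (remove y b) := by
  obtain ⟨f, h₁, h₂, h₃⟩ := h
  refine .of_relation (σ := ![3, 0, 0]) (k := 0)
    -- Rerouting: the element that `f` sends to the deleted `b` is sent to the image of the deleted
    -- `a`.
    (R := fun v c d => kpair c d ∈ₙ v 0 ∨ (kpair c (v 2) ∈ₙ v 0 ∧ kpair (v 1) d ∈ₙ v 0)) ?_
    ![f, a, b] ⟨?_, ?_, ?_⟩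
  · refine SP.or ?_ (SP.and ?_ ?_)
    · exact ST.kpair_mem (k := 0) ST.last.weak ST.last (ST.var' 0 rfl).weak.weak
    · exact ST.kpair_mem (k := 0) ST.last.weak (ST.var' 2 rfl).weak.weak (ST.var' 0 rfl).weak.weak
    · exact ST.kpair_mem (k := 0) (ST.var' 1 rfl).weak.weak ST.last (ST.var' 0 rfl).weak.weak
  · intro c hc
    obtain ⟨hc, hca⟩ := (mem_remove _ _ _).mp hc
    obtain ⟨d, hd, hcd⟩ := h₁ c hc
    by_cases e : d = b
    · subst e
      obtain ⟨d', hd', had'⟩ := h₁ a ha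
      refine ⟨d', (mem_remove _ _ _).mpr ⟨hd', fun e => ?_⟩, .inr ⟨hcd, had'⟩⟩
      exact hca ((h₃ c hc a ha d hd d' hd' hcd had').mpr e.symm)
    · exact ⟨d, (mem_remove _ _ _).mpr ⟨hd, e⟩, .inl hcd⟩
  · intro d hd
    obtain ⟨hd, hdb⟩ := (mem_remove _ _ _).mp hd
    obtain ⟨c, hc, hcd⟩ := h₂ d hd
    by_cases e : c = a
    · subst e
      obtain ⟨c', hc', hcb'⟩ := h₂ b hb
      refine ⟨c', (mem_remove _ _ _).mpr ⟨hc', fun e => ?_⟩, .inr ⟨hcb', hcd⟩⟩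
      exact hdb ((h₃ c hc c' hc' d hd b hb hcd hcb').mp e.symm)
    · exact ⟨c, (mem_remove _ _ _).mpr ⟨hc, e⟩, .inl hcd⟩
  · intro c hc c' hc' d hd d' hd'
    obtain ⟨hc, hca⟩ := (mem_remove _ _ _).mp hc
    obtain ⟨hc', hca'⟩ := (mem_remove _ _ _).mp hc'
    obtain ⟨hd, hdb⟩ := (mem_remove _ _ _).mp hd
    obtain ⟨hd', hdb'⟩ := (mem_remove _ _ _).mp hd'
    rintro (h | ⟨h, k⟩) (h' | ⟨h', k'⟩)
    · exact h₃ c hc c' hc' d hd d' hd' h h'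
    · exact iff_of_false (fun e => hdb ((h₃ c hc c' hc' d hd b hb h h').mp e))
        (fun e => hca ((h₃ c hc a ha d hd d' hd' h k').mpr e))
    · exact iff_of_false (fun e => hdb' ((h₃ c hc c' hc' b hb d' hd' h h').mp e).symm)
        (fun e => hca' ((h₃ a ha c' hc' d hd d' hd' k h').mpr e).symm)
    · exact iff_of_true ((h₃ c hc c' hc' b hb b hb h h').mpr rfl)
        ((h₃ a ha a ha d hd d' hd' k k').mp rfl)

theorem Equip.singImage {x y : M} (h : Equip x y) : Equip (singImage x) (singImage y) := by
  obtain ⟨f, h₁, h₂, h₃⟩ := h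
  refine .of_relation (σ := ![3]) (k := 1)
    (R := fun v c d => ∃ a, ∃ b, kpair a b ∈ₙ v 0 ∧ c = sing a ∧ d = sing b) ?_ ![f]
    ⟨?_, ?_, ?_⟩
  · refine SP.exists 0 ?_
    refine SP.exists 0 ?_
    refine SP.and ?_ (SP.and ?_ ?_)
    · exact ST.kpair_mem (k := 0) ST.last.weak ST.last (ST.var' 0 rfl).weak.weak.weak.weak
    · exact ST.eq 1 ST.last.weak.weak.weak ST.last.weak.sing
    · exact ST.eq 1 ST.last.weak.weak ST.last.sing
  · intro c hc
    obtain ⟨a, ha, rfl⟩ := (mem_singImage _ _).mp hc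
    obtain ⟨b, hb, hab⟩ := h₁ a ha
    exact ⟨sing b, (sing_mem_singImage _ _).mpr hb, a, b, hab, rfl, rfl⟩
  · intro d hd
    obtain ⟨b, hb, rfl⟩ := (mem_singImage _ _).mp hd
    obtain ⟨a, ha, hab⟩ := h₂ b hb
    exact ⟨sing a, (sing_mem_singImage _ _).mpr ha, a, b, hab, rfl, rfl⟩
  · rintro _ hc _ hc' _ hd _ hd' ⟨a, b, hab, rfl, rfl⟩ ⟨a', b', hab', rfl, rfl⟩
    rw [sing_mem_singImage] at hc hc' hd hd'
    have := h₃ a hc a' hc' b hd b' hd' hab hab'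
    exact ⟨fun e => congrArg sing (this.mp (sing_inj e)),
      fun e => congrArg sing (this.mpr (sing_inj e))⟩

/-- Singletons lower or raise both ends of a bijection by one type, so ι‘‘ is injective on
cardinals. -/
theorem Equip.of_singImage {x y : M} (h : Equip (NF.singImage x) (NF.singImage y)) :
    Equip x y := by
  obtain ⟨f, h₁, h₂, h₃⟩ := h
  refine .of_relation (σ := ![4]) (k := 0) (R := fun v a b => kpair (sing a) (sing b) ∈ₙ v 0)
    (ST.kpair_mem (k := 1) ST.last.weak.sing ST.last.sing (ST.var' 0 rfl).weak.weak) ![f]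
    ⟨?_, ?_, ?_⟩
  · intro a ha
    obtain ⟨d, hd, had⟩ := h₁ _ ((sing_mem_singImage _ _).mpr ha)
    obtain ⟨b, hb, rfl⟩ := (mem_singImage _ _).mp hd
    exact ⟨b, hb, had⟩
  · intro b hb
    obtain ⟨c, hc, hcb⟩ := h₂ _ ((sing_mem_singImage _ _).mpr hb)
    obtain ⟨a, ha, rfl⟩ := (mem_singImage _ _).mp hc
    exact ⟨a, ha, hcb⟩
  · intro a ha a' ha' b hb b' hb' h h'
    rw [← sing_mem_singImage] at ha ha' hb hb'
    have := h₃ _ ha _ ha' _ hb _ hb' h h'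
    exact ⟨fun e => sing_inj (this.mp (congrArg sing e)),
      fun e => sing_inj (this.mpr (congrArg sing e))⟩

theorem Equip.pow {x y : M} (h : Equip x y) : Equip (pow x) (pow y) := by
  obtain ⟨f, h₁, h₂, h₃⟩ := h
  have img : ∀ s, s ∈ₙ NF.pow x → ∀ b, b ∈ₙ setOf (fun b => b ∈ₙ y ∧ ∃ a, a ∈ₙ s ∧ kpair a b ∈ₙ f) ↔
      b ∈ₙ y ∧ ∃ a, a ∈ₙ s ∧ kpair a b ∈ₙ f := fun s _ =>
    mem_setOf (σ := ![1, 1, 3]) (k := 0)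
      (P := fun v b => b ∈ₙ v 0 ∧ ∃ a, a ∈ₙ v 1 ∧ kpair a b ∈ₙ v 2)
      ((ST.mem 0 ST.last (ST.var' 0 rfl).weak).and
        (SP.exists 0 ((ST.mem 0 ST.last (ST.var' 1 rfl).weak.weak).and
          (ST.kpair_mem (k := 0) ST.last ST.last.weak (ST.var' 2 rfl).weak.weak)))) ![y, s, f]
  have pre : ∀ t, t ∈ₙ NF.pow y → ∀ a, a ∈ₙ setOf (fun a => a ∈ₙ x ∧ ∃ b, b ∈ₙ t ∧ kpair a b ∈ₙ f) ↔
      a ∈ₙ x ∧ ∃ b, b ∈ₙ t ∧ kpair a b ∈ₙ f := fun t _ =>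
    mem_setOf (σ := ![1, 1, 3]) (k := 0)
      (P := fun v b => b ∈ₙ v 0 ∧ ∃ a, a ∈ₙ v 1 ∧ kpair b a ∈ₙ v 2)
      ((ST.mem 0 ST.last (ST.var' 0 rfl).weak).and
        (SP.exists 0 ((ST.mem 0 ST.last (ST.var' 1 rfl).weak.weak).and
          (ST.kpair_mem (k := 0) ST.last.weak ST.last (ST.var' 2 rfl).weak.weak)))) ![x, t, f]
  refine .of_relation (σ := ![3]) (k := 1)
    -- For `s` within `x` and `t` within `y`, the two clauses together say that `t` is the image of
    -- `s`.
    (R := fun v s t => (∀ a, a ∈ₙ s → ∃ b, b ∈ₙ t ∧ kpair a b ∈ₙ v 0) ∧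
      (∀ b, b ∈ₙ t → ∃ a, a ∈ₙ s ∧ kpair a b ∈ₙ v 0)) ?_ ![f] ⟨?_, ?_, ?_⟩
  · refine SP.and (SP.forall 0 (SP.imp ?_ (SP.exists 0 (SP.and ?_ ?_))))
      (SP.forall 0 (SP.imp ?_ (SP.exists 0 (SP.and ?_ ?_))))
    · exact ST.mem 0 ST.last ST.last.weak.weak
    · exact ST.mem 0 ST.last ST.last.weak.weak
    · exact ST.kpair_mem (k := 0) ST.last.weak ST.last (ST.var' 0 rfl).weak.weak.weak.weak
    · exact ST.mem 0 ST.last ST.last.weak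
    · exact ST.mem 0 ST.last ST.last.weak.weak.weak
    · exact ST.kpair_mem (k := 0) ST.last ST.last.weak (ST.var' 0 rfl).weak.weak.weak.weak
  · intro s hs
    refine ⟨_, (mem_pow _ _).mpr fun b hb => ((img s hs b).mp hb).1, fun a ha => ?_,
      fun b hb => ((img s hs b).mp hb).2⟩
    obtain ⟨b, hb, hab⟩ := h₁ a ((mem_pow _ _).mp hs a ha)
    exact ⟨b, (img s hs b).mpr ⟨hb, a, ha, hab⟩, hab⟩
  · intro t ht
    refine ⟨_, (mem_pow _ _).mpr fun b hb => ((pre t ht b).mp hb).1,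
      fun b hb => ((pre t ht b).mp hb).2, fun b hb => ?_⟩
    obtain ⟨a, ha, hab⟩ := h₂ b ((mem_pow _ _).mp ht b hb)
    exact ⟨a, (pre t ht a).mpr ⟨ha, b, hb, hab⟩, hab⟩
  · rintro s hs s' hs' t ht t' ht' ⟨hst, hts⟩ ⟨hst', hts'⟩
    rw [mem_pow] at hs hs' ht ht'
    constructor
    · rintro rfl
      refine NFModel.ext _ _ fun b => ⟨fun hb => ?_, fun hb => ?_⟩
      · obtain ⟨a, ha, hab⟩ := hts b hb
        obtain ⟨b', hb', hab'⟩ := hst' a ha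
        rwa [(h₃ a (hs a ha) a (hs a ha) b (ht b hb) b' (ht' b' hb') hab hab').mp rfl]
      · obtain ⟨a, ha, hab⟩ := hts' b hb
        obtain ⟨b', hb', hab'⟩ := hst a ha
        rwa [(h₃ a (hs a ha) a (hs a ha) b (ht' b hb) b' (ht b' hb') hab hab').mp rfl]
    · rintro rfl
      refine NFModel.ext _ _ fun a => ⟨fun ha => ?_, fun ha => ?_⟩
      · obtain ⟨b, hb, hab⟩ := hst a ha
        obtain ⟨a', ha', hab'⟩ := hts' b hb
        rwa [(h₃ a (hs a ha) a' (hs' a' ha') b (ht b hb) b (ht b hb) hab hab').mpr rfl]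
      · obtain ⟨b, hb, hab⟩ := hst' a ha
        obtain ⟨a', ha', hab'⟩ := hts b hb
        rwa [(h₃ a (hs' a ha) a' (hs a' ha') b (ht b hb) b (ht b hb) hab hab').mpr rfl]

theorem exists_singImage_eq {x z : M} (h : ∀ w, w ∈ₙ z → w ∈ₙ singImage x) :
    ∃ y, (∀ a, a ∈ₙ y → a ∈ₙ x) ∧ z = singImage y := by
  have hS : ∀ a, a ∈ₙ setOf (fun a => sing a ∈ₙ z) ↔ sing a ∈ₙ z :=
    mem_setOf (σ := ![2]) (k := 0) (P := fun v a => sing a ∈ₙ v 0)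
      (ST.mem 1 ST.last.sing (ST.var' 0 rfl).weak) ![z]
  refine ⟨setOf fun a => sing a ∈ₙ z,
    fun a ha => (sing_mem_singImage _ _).mp (h _ ((hS a).mp ha)), NFModel.ext _ _ fun w => ?_⟩
  constructor
  · intro hw
    obtain ⟨a, _, rfl⟩ := (mem_singImage _ _).mp (h w hw)
    rwa [sing_mem_singImage, hS]
  · intro hw
    obtain ⟨a, ha, rfl⟩ := (mem_singImage _ _).mp hw
    exact (hS a).mp ha

/-- The bijection is {s} ↦ ι‘‘s. Both sides are one type above `s`, so it is stratified, whereas s ↦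
ι‘‘s is not. -/
theorem equip_singImage_pow (x : M) : Equip (singImage (pow x)) (pow (singImage x)) := by
  refine .of_relation (σ := (default : Fin 0 → ℕ)) (k := 2)
    (R := fun _ p q => ∃ s, p = sing s ∧ q = singImage s) ?_ default ⟨?_, ?_, ?_⟩
  · exact SP.exists 1 ((ST.eq 2 ST.last.weak.weak ST.last.sing).and
      (ST.eq 2 ST.last.weak ST.last.singImage))
  · intro p hp
    obtain ⟨s, hs, rfl⟩ := (mem_singImage _ _).mp hp
    refine ⟨singImage s, (mem_pow _ _).mpr fun z hz => ?_, s, rfl, rfl⟩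
    obtain ⟨a, ha, rfl⟩ := (mem_singImage _ _).mp hz
    exact (sing_mem_singImage _ _).mpr ((mem_pow _ _).mp hs a ha)
  · intro q hq
    obtain ⟨s, hs, rfl⟩ := exists_singImage_eq ((mem_pow _ _).mp hq)
    exact ⟨sing s, (sing_mem_singImage _ _).mpr ((mem_pow _ _).mpr hs), s, rfl, rfl⟩
  · rintro _ - _ - _ - _ - ⟨s, rfl, rfl⟩ ⟨s', rfl, rfl⟩
    refine ⟨fun e => congrArg singImage (sing_inj e), fun e => congrArg sing ?_⟩
    exact NFModel.ext _ _ fun a => by rw [← sing_mem_singImage, e, sing_mem_singImage]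

/-! ## The axiom of infinity -/

variable (M) in
/-- All sets of the model obey finite induction. -/
def AllFinite : Prop :=
  ∀ X : M, empty M ∈ₙ X → (∀ x a, x ∈ₙ X → ¬ a ∈ₙ x → insert x a ∈ₙ X) → ∀ x, x ∈ₙ X

theorem AllFinite.induction (hF : AllFinite M) {P : (Fin n → M) → M → Prop}
    (h : SP (Fin.snoc σ k : Fin (n + 1) → ℕ) (fun w => P (Fin.init w) (w (Fin.last n))))
    (v : Fin n → M) (h₀ : P v (NF.empty M))
    (h₁ : ∀ x a, P v x → ¬ a ∈ₙ x → P v (NF.insert x a)) (x : M) : P v x := by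
  have H := mem_setOf h v
  refine (H x).mp (hF _ ((H _).mpr h₀) (fun x a hx ha => ?_) x)
  exact (H _).mpr (h₁ x a ((H x).mp hx) ha)

theorem eq_empty {x : M} (h : ∀ z, ¬ z ∈ₙ x) : x = empty M :=
  NFModel.ext _ _ fun z => iff_of_false (h z) (mem_empty z)

theorem insert_remove {x a : M} (ha : a ∈ₙ x) : insert (remove x a) a = x :=
  NFModel.ext _ _ fun z => by
    rw [mem_insert, mem_remove]
    by_cases e : z = a
    · subst e
      simpa using ha
    · simp [e]

theorem remove_insert {x a : M} (ha : ¬ a ∈ₙ x) : remove (insert x a) a = x :=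
  NFModel.ext _ _ fun z => by
    rw [mem_remove, mem_insert]
    by_cases e : z = a
    · subst e
      simpa using ha
    · simp [e]

/-! ### Cardinal arithmetic in a finite universe. -/

theorem AllFinite.eq_of_subset_of_equip (hF : AllFinite M) (x : M) :
    ∀ v, (∀ z, z ∈ₙ v → z ∈ₙ x) → Equip v x → v = x := by
  refine hF.induction (σ := (default : Fin 0 → ℕ)) (k := 1)
    (P := fun _ x => ∀ v, (∀ z, z ∈ₙ v → z ∈ₙ x) → Equip v x → v = x) ?_ default ?_ ?_ x
  · refine SP.forall 1 (SP.imp ?_ (SP.imp ?_ ?_))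
    · exact SP.forall 0 ((ST.mem 0 ST.last ST.last.weak).imp (ST.mem 0 ST.last ST.last.weak.weak))
    · exact SP.equip (k := 0) ST.last ST.last.weak
    · exact ST.eq 1 ST.last ST.last.weak
  · exact fun v hv _ => eq_empty fun z hz => mem_empty z (hv z hz)
  · intro u a ih ha v hv e
    by_cases hav : a ∈ₙ v
    · have e' := e.remove hav ((mem_insert u a a).mpr (.inr rfl))
      rw [remove_insert ha] at e'
      rw [← ih _ (fun z hz => ?_) e', insert_remove hav]
      obtain ⟨hz, hza⟩ := (mem_remove _ _ _).mp hz
      exact ((mem_insert _ _ _).mp (hv z hz)).resolve_right hza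
    -- Otherwise `v` lies in `u`. Deleting from `v` the element `b` matched with `a` leaves a subset
    -- of `u` equinumerous with `u`, hence `u` itself, although it omits `b`.
    · have hvu : ∀ z, z ∈ₙ v → z ∈ₙ u := fun z hz =>
        ((mem_insert _ _ _).mp (hv z hz)).resolve_right fun e => hav (e ▸ hz)
      obtain ⟨f, -, h₂, -⟩ := id e
      obtain ⟨b, hb, -⟩ := h₂ a ((mem_insert u a a).mpr (.inr rfl))
      have e' := e.remove hb ((mem_insert u a a).mpr (.inr rfl))
      rw [remove_insert ha] at e'
      have := ih _ (fun z hz => hvu z ((mem_remove _ _ _).mp hz).1) e'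
      exact absurd rfl ((mem_remove v b b).mp (this ▸ hvu b hb)).2

/-- `x` is equinumerous with a subset of `y`. -/
def Embeds (x y : M) : Prop := ∃ z, (∀ w, w ∈ₙ z → w ∈ₙ y) ∧ Equip x z

theorem SP.embeds (hs : ST σ (k + 1) s) (ht : ST σ (k + 1) t) :
    SP σ (fun v => Embeds (s v) (t v)) := by
  refine SP.exists (k + 1) (SP.and ?_ ?_)
  · exact SP.forall k ((ST.mem k ST.last ST.last.weak).imp (ST.mem k ST.last ht.weak.weak))
  · exact SP.equip hs.weak ST.last

theorem Embeds.of_subset {x y : M} (h : ∀ z, z ∈ₙ x → z ∈ₙ y) : Embeds x y := ⟨x, h, .refl x⟩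

theorem Equip.embeds {x y : M} (h : Equip x y) : Embeds x y := ⟨y, fun _ => id, h⟩

theorem Embeds.trans {x y z : M} : Embeds x y → Embeds y z → Embeds x z := by
  rintro ⟨y', hy', e⟩ ⟨z', hz', e'⟩
  obtain ⟨z'', hz'', e''⟩ := e'.restrict hy'
  exact ⟨z'', fun w hw => hz' w (hz'' w hw), e.trans e''⟩

theorem AllFinite.eq_of_subset_of_embeds (hF : AllFinite M) {x v : M}
    (hv : ∀ z, z ∈ₙ v → z ∈ₙ x) : Embeds x v → v = x := by
  rintro ⟨v', hv', e⟩
  have := hF.eq_of_subset_of_equip x v' (fun z hz => hv z (hv' z hz)) e.symm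
  subst this
  exact NFModel.ext _ _ fun z => ⟨hv z, hv' z⟩

theorem AllFinite.equip_of_embeds (hF : AllFinite M) {x y : M} :
    Embeds x y → Embeds y x → Equip x y := by
  rintro ⟨y', hy', e⟩ h
  have := hF.eq_of_subset_of_embeds hy' (h.trans e.embeds)
  rwa [this] at e

theorem AllFinite.embeds_total (hF : AllFinite M) (u x : M) : Embeds x u ∨ Embeds u x := by
  refine hF.induction (σ := ![1]) (k := 1)
    (P := fun v x => Embeds x (v 0) ∨ Embeds (v 0) x) ?_ ![u] ?_ ?_ x
  · exact (SP.embeds (k := 0) ST.last (ST.var' 0 rfl).weak).or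
      (SP.embeds (k := 0) (ST.var' 0 rfl).weak ST.last)
  · exact .inl (.of_subset fun z hz => absurd hz (mem_empty z))
  · rintro x a (⟨z, hz, e⟩ | h) ha
    -- If the copy of `x` leaves room in `u`, the new element goes there; if not, `u` is
    -- equinumerous with `x`.
    · by_cases H : ∃ b, b ∈ₙ u ∧ ¬ b ∈ₙ z
      · obtain ⟨b, hb, hbz⟩ := H
        refine .inl ⟨insert z b, fun w hw => ?_, e.insert ha hbz⟩
        rcases (mem_insert _ _ _).mp hw with hw | rfl
        · exact hz w hw
        · exact hb
      · have : z = u := NFModel.ext _ _ fun w =>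
          ⟨hz w, fun hw => by_contra fun hwz => H ⟨w, hw, hwz⟩⟩
        subst this
        exact .inr (e.symm.embeds.trans (.of_subset fun w hw => (mem_insert _ _ _).mpr (.inl hw)))
    · exact .inr (h.trans (.of_subset fun w hw => (mem_insert _ _ _).mpr (.inl hw)))

theorem pow_inj {x y : M} (h : pow x = pow y) : x = y :=
  NFModel.ext _ _ fun z =>
    ⟨(mem_pow y x).mp (h ▸ (mem_pow x x).mpr fun _ => id) z,
      (mem_pow x y).mp (h ▸ (mem_pow y y).mpr fun _ => id) z⟩

/-- By comparability, the alternative is that `y` is equinumerous with a subset `z` of `x`. Then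
`pow z` is a subset of `pow x` into which `pow x` embeds, so finiteness gives `pow z = pow x` and `z
= x`. -/
theorem AllFinite.embeds_of_pow (hF : AllFinite M) {x y : M} (h : Embeds (pow x) (pow y)) :
    Embeds x y := by
  refine (hF.embeds_total y x).elim id ?_
  rintro ⟨z, hz, e⟩
  have : pow z = pow x := hF.eq_of_subset_of_embeds
    (fun s hs => (mem_pow _ _).mpr fun w hw => hz w ((mem_pow _ _).mp hs w hw))
    (h.trans e.pow.embeds)
  rw [← pow_inj this]
  exact e.symm.embeds

theorem AllFinite.equip_of_pow (hF : AllFinite M) {x y : M} (h : Equip (pow x) (pow y)) :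
    Equip x y :=
  hF.equip_of_embeds (hF.embeds_of_pow h.embeds) (hF.embeds_of_pow h.symm.embeds)

/-- Logarithms can be pulled back along ι‘‘. Since V is its own power set, ι‘‘x embeds in ι‘‘(pow V)
and so in pow(ι‘‘V). Hence `w` embeds in ι‘‘V and is equinumerous with some ι‘‘y, and both sides
become images under ι‘‘. -/
theorem AllFinite.exists_equip_pow_of_singImage (hF : AllFinite M) {x w : M}
    (h : Equip (singImage x) (pow w)) : ∃ z, Equip x (pow z) := by
  have h₁ : Embeds (pow w) (pow (singImage (univ M))) := by
    refine h.symm.embeds.trans (.trans (y := singImage (pow (univ M))) ?_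
      (equip_singImage_pow _).embeds)
    refine .of_subset fun z hz => ?_
    obtain ⟨a, _, rfl⟩ := (mem_singImage _ _).mp hz
    rw [sing_mem_singImage, pow_univ]
    exact mem_univ a
  obtain ⟨z, hz, e⟩ := hF.embeds_of_pow h₁
  obtain ⟨y, -, rfl⟩ := exists_singImage_eq hz
  exact ⟨y, (h.trans (e.pow.trans (equip_singImage_pow y).symm)).of_singImage⟩

/-- Induction along the operation which takes a set of cardinality `2 ^ |ι‘‘y|` to `ι‘‘y`. -/
theorem AllFinite.log_induction (hF : AllFinite M) {P : (Fin n → M) → M → Prop}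
    (h : SP (Fin.snoc σ (k + 2) : Fin (n + 1) → ℕ) (fun w => P (Fin.init w) (w (Fin.last n))))
    (v : Fin n → M) (ih : ∀ x, (∀ y, Equip x (NF.pow y) → P v (NF.singImage y)) → P v x)
    (x : M) : P v x := by
  obtain ⟨X, hX⟩ : ∃ X : M, ∀ x, x ∈ₙ X ↔ P v x := ⟨_, mem_setOf h v⟩
  -- Strong induction on cardinality, written as finite induction on a bound `u`.
  suffices H : ∀ u x, Embeds x u → x ∈ₙ X from (hX x).mp (H x x (.of_subset fun _ => id))
  refine hF.induction (σ := ![3]) (k := 2) (P := fun v u => ∀ x, Embeds x u → x ∈ₙ v 0) ?_ ![X]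
    ?_ ?_
  · exact SP.forall 2 (SP.imp (SP.embeds (k := 1) ST.last ST.last.weak)
      (ST.mem 2 ST.last (ST.var' 0 rfl).weak.weak))
  · rintro x ⟨z, hz, e⟩
    -- With bound ∅ the hypothesis `hy` is impossible, since a power set contains ∅.
    refine (hX x).mpr (ih x fun y hy => ?_)
    obtain ⟨f, h₁, -⟩ := hy.symm.trans e
    obtain ⟨b, hb, -⟩ := h₁ (empty M) ((mem_pow _ _).mpr fun z hz => absurd hz (mem_empty z))
    exact absurd (hz b hb) (mem_empty b)
  · rintro u a H ha x ⟨z, hz, e⟩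
    refine (hX x).mpr (ih x fun y hy => (hX _).mp (H _ ?_))
    have e' := hy.symm.trans e
    have h₀ : empty M ∈ₙ NF.pow y := (mem_pow _ _).mpr fun z hz => absurd hz (mem_empty z)
    -- This is where the logarithm is strictly smaller: ι‘‘y misses the element ∅ of `pow y`, so ∅
    -- can be deleted to pay for losing `a` from the bound.
    have hsub : ∀ w, w ∈ₙ NF.singImage y → w ∈ₙ remove (NF.pow y) (empty M) := by
      intro w hw
      obtain ⟨b, hb, rfl⟩ := (mem_singImage _ _).mp hw
      refine (mem_remove _ _ _).mpr ⟨(mem_pow _ _).mpr fun c hc => ?_, fun e => ?_⟩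
      · rwa [(mem_sing _ _).mp hc]
      · exact mem_empty b (e ▸ (mem_sing b b).mpr rfl)
    by_cases haz : a ∈ₙ z
    · refine (Embeds.of_subset hsub).trans ((e'.remove h₀ haz).embeds.trans (.of_subset ?_))
      intro w hw
      obtain ⟨hw, hwa⟩ := (mem_remove _ _ _).mp hw
      exact ((mem_insert _ _ _).mp (hz w hw)).resolve_right hwa
    · refine (Embeds.of_subset fun w hw => ((mem_remove _ _ _).mp (hsub w hw)).1).trans
        (e'.embeds.trans (.of_subset fun w hw => ?_))
      exact ((mem_insert _ _ _).mp (hz w hw)).resolve_right fun e => haz (e ▸ hw)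

/-! ### The parity of the number of logarithms, and the contradiction. -/

/-- A set of the model which contains every set that is not equinumerous with a power set, and which
separates a set of cardinality `2 ^ |ι‘‘y|` from `ι‘‘y`. -/
def IsColoring (S : M) : Prop :=
  (∀ x, (¬ ∃ y, Equip x (pow y)) → x ∈ₙ S) ∧
    ∀ x y, Equip x (pow y) → (x ∈ₙ S ↔ ¬ singImage y ∈ₙ S)

/-- `X` contains every set that is not equinumerous with a power set, and is closed under taking two
base-two exponentials of cardinalities. -/
def IsLogClosed (X : M) : Prop :=
  (∀ x, (¬ ∃ y, Equip x (pow y)) → x ∈ₙ X) ∧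
    ∀ x y z, Equip x (pow y) → Equip (singImage y) (pow z) → singImage z ∈ₙ X → x ∈ₙ X

theorem SP.isLogClosed (h : ST σ (k + 3) t) : SP σ (fun v => IsLogClosed (t v)) := by
  refine SP.and ?_ ?_
  · refine SP.forall (k + 2) (SP.imp (SP.not ?_) (ST.mem (k + 2) ST.last h.weak))
    exact SP.exists (k + 1) (SP.equip (k := k + 1) ST.last.weak ST.last.pow)
  · refine SP.forall (k + 2) ?_
    refine SP.forall (k + 1) ?_
    refine SP.forall (k + 1) (SP.imp ?_ (SP.imp ?_ (SP.imp ?_ ?_)))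
    · exact SP.equip (k := k + 1) ST.last.weak.weak ST.last.weak.pow
    · exact SP.equip (k := k + 1) ST.last.weak.singImage ST.last.pow
    · exact ST.mem (k + 2) ST.last.singImage h.weak.weak.weak
    · exact ST.mem (k + 2) ST.last.weak.weak h.weak.weak.weak

/-- `S` is the intersection of all log-closed sets. The set of `x` satisfying the inversion
principle is itself log-closed, so it contains `S`. -/
theorem exists_least_isLogClosed :
    ∃ S : M, IsLogClosed S ∧ ∀ x, x ∈ₙ S →
      (¬ ∃ y, Equip x (pow y)) ∨
        ∃ y, Equip x (pow y) ∧ ∃ z, Equip (singImage y) (pow z) ∧ singImage z ∈ₙ S := by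
  obtain ⟨S, hS⟩ : ∃ S : M, ∀ x, x ∈ₙ S ↔ ∀ X, IsLogClosed X → x ∈ₙ X :=
    ⟨_, mem_setOf (σ := (default : Fin 0 → ℕ)) (k := 2)
      (P := fun _ x => ∀ X, IsLogClosed X → x ∈ₙ X)
      (SP.forall 3 (SP.imp (SP.isLogClosed (k := 0) ST.last) (ST.mem 2 ST.last.weak ST.last)))
      default⟩
  have hc : IsLogClosed S := by
    refine ⟨fun x hx => (hS x).mpr fun X hX => hX.1 x hx, fun x y z hxy hyz hz => ?_⟩
    exact (hS x).mpr fun X hX => hX.2 x y z hxy hyz ((hS _).mp hz X hX)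
  refine ⟨S, hc, ?_⟩
  obtain ⟨X, hX⟩ : ∃ X : M, ∀ x, x ∈ₙ X ↔ (¬ ∃ y, Equip x (pow y)) ∨
      ∃ y, Equip x (pow y) ∧ ∃ z, Equip (singImage y) (pow z) ∧ singImage z ∈ₙ S := by
    refine ⟨_, mem_setOf (σ := ![3]) (k := 2) (P := fun v x => (¬ ∃ y, Equip x (pow y)) ∨
      ∃ y, Equip x (pow y) ∧ ∃ z, Equip (singImage y) (pow z) ∧ singImage z ∈ₙ v 0) ?_ ![S]⟩
    refine SP.or (SP.not ?_) ?_
    · exact SP.exists 1 (SP.equip (k := 1) ST.last.weak ST.last.pow)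
    · refine SP.exists 1 (SP.and ?_ ?_)
      · exact SP.equip (k := 1) ST.last.weak ST.last.pow
      · refine SP.exists 1 (SP.and ?_ ?_)
        · exact SP.equip (k := 1) ST.last.weak.singImage ST.last.pow
        · exact ST.mem 2 ST.last.singImage (ST.var' 0 rfl).weak.weak.weak
  intro x hx
  refine (hX x).mp ((hS x).mp hx X ⟨fun x hx => (hX x).mpr (.inl hx), ?_⟩)
  intro x y z hxy hyz hz
  refine (hX x).mpr (.inr ⟨y, hxy, z, hyz, ?_⟩)
  rcases (hX _).mp hz with h | ⟨y', h₁, z', h₂, h₃⟩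
  · exact hc.1 _ h
  · exact hc.2 _ _ _ h₁ h₂ h₃

/-- The least log-closed set consists of the sets with an even number of logarithms. That parity
flips at each logarithm is proved by `AllFinite.log_induction`; it needs logarithms to be unique up
to equinumerosity, which finiteness supplies. -/
theorem AllFinite.exists_isColoring (hF : AllFinite M) : ∃ S : M, IsColoring S := by
  obtain ⟨S, hc, hS⟩ := exists_least_isLogClosed (M := M)
  have inv : ∀ x x', Equip x x' → x ∈ₙ S → x' ∈ₙ S := by
    intro x x' e hx
    rcases hS x hx with h | ⟨y, h₁, z, h₂, h₃⟩
    · exact hc.1 _ fun ⟨y, hy⟩ => h ⟨y, e.trans hy⟩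
    · exact hc.2 _ _ _ (e.symm.trans h₁) h₂ h₃
  refine ⟨S, hc.1, ?_⟩
  refine hF.log_induction (σ := ![3]) (k := 0)
    (P := fun v x => ∀ y, Equip x (NF.pow y) → (x ∈ₙ v 0 ↔ ¬ NF.singImage y ∈ₙ v 0)) ?_ ![S] ?_
  · refine SP.forall 1 (SP.imp (SP.equip (k := 1) ST.last.weak ST.last.pow) (SP.iff ?_ ?_))
    · exact ST.mem 2 ST.last.weak (ST.var' 0 rfl).weak.weak
    · exact (ST.mem 2 ST.last.singImage (ST.var' 0 rfl).weak.weak).not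
  · intro x ih y hxy
    change x ∈ₙ S ↔ ¬ singImage y ∈ₙ S
    -- The inversion principle yields some logarithm ι‘‘y' of `x`; by `AllFinite.equip_of_pow` it
    -- can be replaced by the given ι‘‘y.
    have inversion : x ∈ₙ S → ∃ z, Equip (singImage y) (NF.pow z) ∧ singImage z ∈ₙ S := by
      intro hx
      rcases hS x hx with h | ⟨y', h₁, z, h₂, h₃⟩
      · exact absurd ⟨y, hxy⟩ h
      · exact ⟨z, ((hF.equip_of_pow (hxy.symm.trans h₁)).singImage).trans h₂, h₃⟩
    by_cases hp : ∃ z, Equip (singImage y) (NF.pow z)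
    · obtain ⟨z, hz⟩ := hp
      have ihz : singImage y ∈ₙ S ↔ ¬ singImage z ∈ₙ S := ih y hxy z hz
      rw [ihz, not_not]
      refine ⟨fun hx => ?_, fun h => hc.2 x y z hxy hz h⟩
      obtain ⟨z', hz', h⟩ := inversion hx
      exact inv _ _ (hF.equip_of_pow (hz'.symm.trans hz)).singImage h
    -- Here ι‘‘y has no logarithm, so it is in `S` at stage zero, while `x` has exactly one
    -- logarithm and cannot be in `S`.
    · refine iff_of_false (fun hx => ?_) (not_not.mpr (hc.1 _ hp))
      obtain ⟨z, hz, -⟩ := inversion hx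
      exact hp ⟨z, hz⟩

theorem not_allFinite : ¬ AllFinite M := by
  intro hF
  obtain ⟨S, h₁, h₂⟩ := hF.exists_isColoring
  -- With a single variable for `S` this predicate is not stratified. Comprehension allows
  -- parameters, so `S` is supplied twice, as two variables of types 3 and 4.
  have key : ∀ x, x ∈ₙ S ↔ singImage x ∈ₙ S := by
    refine hF.log_induction (σ := ![3, 4]) (k := 0)
      (P := fun v x => x ∈ₙ v 0 ↔ singImage x ∈ₙ v 1) ?_ ![S, S] ?_
    · exact (ST.mem 2 ST.last (ST.var' 0 rfl).weak).iff
        (ST.mem 3 ST.last.singImage (ST.var' 1 rfl).weak)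
    · intro x ih
      change x ∈ₙ S ↔ singImage x ∈ₙ S
      by_cases hp : ∃ y, Equip x (NF.pow y)
      · obtain ⟨y, hy⟩ := hp
        rw [h₂ x y hy, h₂ _ _ (hy.singImage.trans (equip_singImage_pow y))]
        exact not_congr (ih y hy)
      · refine iff_of_true (h₁ x hp) (h₁ _ fun ⟨w, hw⟩ => hp ?_)
        exact hF.exists_equip_pow_of_singImage hw
  -- V has ι‘‘V as its logarithm, so `S` must separate V from ι‘‘V, contrary to `key`.
  have hV : Equip (univ M) (NF.pow (univ M)) := by
    rw [pow_univ]
    exact .refl _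
  have h := h₂ _ _ hV
  rw [← key] at h
  exact iff_not_self h

/-! ## Frege's natural numbers -/

theorem mem_succ (m z : M) :
    z ∈ₙ succ m ↔ ∃ x, x ∈ₙ m ∧ ∃ y, ¬ y ∈ₙ x ∧ z = insert x y :=
  mem_setOf (σ := ![2]) (k := 1)
    (P := fun v z => ∃ x, x ∈ₙ v 0 ∧ ∃ y, ¬ y ∈ₙ x ∧ z = insert x y)
    (SP.exists 1 ((ST.mem 1 ST.last (ST.var' 0 rfl).weak.weak).and
      (SP.exists 0 ((ST.mem 0 ST.last ST.last.weak).not.and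
        (ST.eq 1 ST.last.weak.weak (ST.last.weak.insert ST.last)))))) ![m] z

theorem mem_zero (z : M) : z ∈ₙ zero M ↔ z = empty M := mem_sing _ _

theorem mem_nat (m : M) :
    m ∈ₙ nat M ↔ ∀ X, (zero M ∈ₙ X ∧ ∀ m, m ∈ₙ X → succ m ∈ₙ X) → m ∈ₙ X := by
  refine mem_setOf (σ := (default : Fin 0 → ℕ)) (k := 2)
    (P := fun _ m => ∀ X, (zero M ∈ₙ X ∧ ∀ m, m ∈ₙ X → succ m ∈ₙ X) → m ∈ₙ X) ?_ default m
  refine SP.forall 3 (SP.imp (SP.and ?_ (SP.forall 2 (SP.imp ?_ ?_))) ?_)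
  · exact ST.mem 2 (ST.zero (k := 0)) ST.last
  · exact ST.mem 2 ST.last ST.last.weak
  · exact ST.mem 2 (ST.last.succ (k := 0)) ST.last.weak
  · exact ST.mem 2 ST.last.weak ST.last

theorem zero_mem_nat : zero M ∈ₙ nat M := (mem_nat _).mpr fun _ hX => hX.1

theorem succ_mem_nat {m : M} (hm : m ∈ₙ nat M) : succ m ∈ₙ nat M :=
  (mem_nat _).mpr fun X hX => hX.2 m ((mem_nat m).mp hm X hX)

theorem nat_induction {P : (Fin n → M) → M → Prop}
    (h : SP (Fin.snoc σ k : Fin (n + 1) → ℕ) (fun w => P (Fin.init w) (w (Fin.last n))))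
    (v : Fin n → M) (h₀ : P v (NF.zero M)) (h₁ : ∀ m, P v m → P v (NF.succ m))
    {m : M} (hm : m ∈ₙ NF.nat M) : P v m := by
  have H := mem_setOf h v
  exact (H m).mp ((mem_nat m).mp hm _ ⟨(H _).mpr h₀, fun m hm => (H _).mpr (h₁ m ((H m).mp hm))⟩)

/-- If V belonged to a Frege number, induction on that number would build every set from ∅ by
adjoining elements, which is `AllFinite`. -/
theorem univ_notMem_of_mem_nat {m : M} (hm : m ∈ₙ nat M) : ¬ univ M ∈ₙ m := by
  intro hV
  refine not_allFinite (M := M) fun X h₀ h₁ => ?_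
  -- The induction covers all subsets of members of `m`, so that V in `m` puts every set in `X`.
  have H : ∀ z, z ∈ₙ m → ∀ y, (∀ w, w ∈ₙ y → w ∈ₙ z) → y ∈ₙ X := by
    refine nat_induction (σ := ![2]) (k := 2)
      (P := fun v m => ∀ z, z ∈ₙ m → ∀ y, (∀ w, w ∈ₙ y → w ∈ₙ z) → y ∈ₙ v 0) ?_ ![X] ?_ ?_ hm
    · refine SP.forall 1 ((ST.mem 1 ST.last ST.last.weak).imp ?_)
      refine SP.forall 1 (SP.imp (SP.forall 0 (SP.imp ?_ ?_)) ?_)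
      · exact ST.mem 0 ST.last ST.last.weak
      · exact ST.mem 0 ST.last ST.last.weak.weak
      · exact ST.mem 1 ST.last (ST.var' 0 rfl).weak.weak.weak
    · intro z hz y hy
      obtain rfl := (mem_zero z).mp hz
      rwa [eq_empty fun w hw => mem_empty w (hy w hw)]
    · intro m ih z hz y hy
      obtain ⟨x, hx, a, ha, rfl⟩ := (mem_succ _ _).mp hz
      by_cases hay : a ∈ₙ y
      · rw [← insert_remove hay]
        refine h₁ _ _ (ih x hx _ fun w hw => ?_) fun h => ((mem_remove _ _ _).mp h).2 rfl
        obtain ⟨hw, hwa⟩ := (mem_remove _ _ _).mp hw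
        exact ((mem_insert _ _ _).mp (hy w hw)).resolve_right hwa
      · exact ih x hx y fun w hw =>
          ((mem_insert _ _ _).mp (hy w hw)).resolve_right fun e => hay (e ▸ hw)
  exact fun x => H _ hV x fun w _ => mem_univ w

/-- Membership in `succ m` exhibits one element whose removal lands in `m`. By induction any element
will do: adjoining `a` and removing a different `y` commute. -/
theorem remove_mem_of_mem_succ {m : M} (hm : m ∈ₙ nat M) :
    ∀ z, z ∈ₙ succ m → ∀ y, y ∈ₙ z → remove z y ∈ₙ m := by
  have SPremove : ∀ {n : ℕ} {σ : Fin n → ℕ} {s t : (Fin n → M) → M}, ST σ 1 s → ST σ 0 t →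
      ST σ 1 (fun v => remove (s v) (t v)) := fun hs ht =>
    ST.setOf (k := 0) ((ST.mem 0 ST.last hs.weak).and (ST.eq 0 ST.last ht.weak).not)
  refine nat_induction (σ := (default : Fin 0 → ℕ)) (k := 2)
    (P := fun _ m => ∀ z, z ∈ₙ succ m → ∀ y, y ∈ₙ z → remove z y ∈ₙ m) ?_ default ?_ ?_ hm
  · refine SP.forall 1 ((ST.mem 1 ST.last (ST.last.succ (k := 0)).weak).imp ?_)
    refine SP.forall 0 ((ST.mem 0 ST.last ST.last.weak).imp ?_)
    exact ST.mem 1 (SPremove ST.last.weak ST.last) ST.last.weak.weak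
  · intro z hz y hy
    obtain ⟨x, hx, a, ha, rfl⟩ := (mem_succ _ _).mp hz
    obtain rfl := (mem_zero x).mp hx
    obtain rfl := ((mem_insert _ _ _).mp hy).resolve_left (mem_empty y)
    rwa [remove_insert ha]
  · intro m ih z hz y hy
    obtain ⟨x, hx, a, ha, rfl⟩ := (mem_succ _ _).mp hz
    by_cases e : y = a
    · subst e
      rwa [remove_insert ha]
    · have hyx := ((mem_insert _ _ _).mp hy).resolve_right e
      refine (mem_succ _ _).mpr ⟨_, ih x hx y hyx, a, fun h => ha ((mem_remove _ _ _).mp h).1, ?_⟩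
      refine NFModel.ext _ _ fun z => ?_
      simp only [mem_remove, mem_insert]
      grind

/-- Infinity enters here: a member `x` of `m` is not V, so some `y` is outside it. Then `insert x y`
lies in both successors, and removing `y` puts `x` in `m'`. -/
theorem succ_inj {m m' : M} (hm : m ∈ₙ nat M) (hm' : m' ∈ₙ nat M) (e : succ m = succ m') :
    m = m' := by
  have key : ∀ m m' : M, m ∈ₙ nat M → m' ∈ₙ nat M → succ m = succ m' → ∀ x, x ∈ₙ m → x ∈ₙ m' := by
    intro m m' hm hm' e x hx
    obtain ⟨y, hy⟩ : ∃ y, ¬ y ∈ₙ x := by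
      by_contra! H
      refine univ_notMem_of_mem_nat hm ?_
      rwa [NFModel.ext (univ M) x fun z => iff_of_true (mem_univ z) (H z)]
    have h : insert x y ∈ₙ succ m' := e ▸ (mem_succ _ _).mpr ⟨x, hx, y, hy, rfl⟩
    have := remove_mem_of_mem_succ hm' _ h y ((mem_insert _ _ _).mpr (.inr rfl))
    rwa [remove_insert hy] at this
  exact NFModel.ext _ _ fun x => ⟨key m m' hm hm' e x, key m' m hm' hm e.symm x⟩

theorem succ_ne_zero (m : M) : succ m ≠ zero M := by
  intro e
  obtain ⟨x, _, y, _, h⟩ := (mem_succ _ _).mp (e ▸ (mem_zero _).mpr rfl : empty M ∈ₙ succ m)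
  exact mem_empty y (h ▸ (mem_insert x y y).mpr (.inr rfl))

/-! ## Quine's pairs -/

theorem mem_shift (a z : M) :
    z ∈ₙ shift a ↔ (∃ m, m ∈ₙ a ∧ m ∈ₙ nat M ∧ z = succ m) ∨ (z ∈ₙ a ∧ ¬ z ∈ₙ nat M) :=
  mem_setOf (σ := ![3]) (k := 2)
    (P := fun v z => (∃ m, m ∈ₙ v 0 ∧ m ∈ₙ nat M ∧ z = succ m) ∨ (z ∈ₙ v 0 ∧ ¬ z ∈ₙ nat M))
    (SP.or
      (SP.exists 2 ((ST.mem 2 ST.last (ST.var' 0 rfl).weak.weak).and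
        ((ST.mem 2 ST.last (ST.nat (k := 0))).and
          (ST.eq 2 ST.last.weak (ST.last.succ (k := 0))))))
      ((ST.mem 2 ST.last (ST.var' 0 rfl).weak).and (ST.mem 2 ST.last (ST.nat (k := 0))).not)) ![a] z

theorem mem_pair (x y z : M) :
    z ∈ₙ pair x y ↔
      (∃ a, a ∈ₙ x ∧ z = shift a) ∨ (∃ b, b ∈ₙ y ∧ z = insert (shift b) (zero M)) :=
  mem_setOf (σ := ![4, 4]) (k := 3)
    (P := fun v z => (∃ a, a ∈ₙ v 0 ∧ z = shift a) ∨
      (∃ b, b ∈ₙ v 1 ∧ z = insert (shift b) (zero M)))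
    (SP.or
      (SP.exists 3 ((ST.mem 3 ST.last (ST.var' 0 rfl).weak.weak).and
        (ST.eq 3 ST.last.weak (ST.last.shift (k := 0)))))
      (SP.exists 3 ((ST.mem 3 ST.last (ST.var' 1 rfl).weak.weak).and
        (ST.eq 3 ST.last.weak ((ST.last.shift (k := 0)).insert (ST.zero (k := 0))))))) ![x, y] z

theorem zero_notMem_shift (a : M) : ¬ zero M ∈ₙ shift a := by
  rw [mem_shift]
  rintro (⟨m, _, _, e⟩ | ⟨_, h⟩)
  · exact succ_ne_zero m e.symm
  · exact h zero_mem_nat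

/-- Numbers are sent injectively to numbers and the other elements are fixed, so the two kinds
cannot collide. -/
theorem shift_inj {a b : M} (e : shift a = shift b) : a = b := by
  have key : ∀ a b : M, shift a = shift b → ∀ z, z ∈ₙ a → z ∈ₙ b := by
    intro a b e z hz
    by_cases hn : z ∈ₙ nat M
    · rcases (mem_shift b _).mp (e ▸ (mem_shift a _).mpr (.inl ⟨z, hz, hn, rfl⟩)) with
        ⟨m, hm, hmn, e'⟩ | ⟨_, h⟩
      · rwa [succ_inj hn hmn e']
      · exact absurd (succ_mem_nat hn) h
    · rcases (mem_shift b _).mp (e ▸ (mem_shift a _).mpr (.inr ⟨hz, hn⟩)) with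
        ⟨m, _, hmn, rfl⟩ | ⟨h, _⟩
      · exact absurd (succ_mem_nat hmn) hn
      · exact h
  exact NFModel.ext _ _ fun z => ⟨key a b e z, key b a e.symm z⟩

theorem shift_mem_pair (x y a : M) : shift a ∈ₙ pair x y ↔ a ∈ₙ x := by
  rw [mem_pair]
  constructor
  · rintro (⟨b, hb, e⟩ | ⟨b, _, e⟩)
    · rwa [shift_inj e]
    · exact absurd (e ▸ (mem_insert _ _ _).mpr (.inr rfl)) (zero_notMem_shift a)
  · exact fun ha => .inl ⟨a, ha, rfl⟩

theorem insert_shift_mem_pair (x y b : M) :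
    insert (shift b) (zero M) ∈ₙ pair x y ↔ b ∈ₙ y := by
  rw [mem_pair]
  constructor
  · rintro (⟨a, _, e⟩ | ⟨a, ha, e⟩)
    · exact absurd (e ▸ (mem_insert _ _ _).mpr (.inr rfl)) (zero_notMem_shift a)
    -- The marker 0 is absent from both shifted sets, so deleting it recovers them.
    · have := congrArg (remove · (zero M)) e
      simp only [remove_insert (zero_notMem_shift _)] at this
      rwa [shift_inj this]
  · exact fun hb => .inr ⟨b, hb, rfl⟩

theorem quinePairing : QuinePairing M := by
  intro x y x' y' e
  refine ⟨NFModel.ext _ _ fun a => ?_, NFModel.ext _ _ fun b => ?_⟩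
  · rw [← shift_mem_pair x y, e, shift_mem_pair]
  · rw [← insert_shift_mem_pair x y, e, insert_shift_mem_pair]

end Finite

section Closed

variable {M : Type u} [setLang.Structure M] [NFModel M] {h : QuinePairing M}

/-! ## Arrows between products and function sets -/

/-- One inclusion of graphs suffices, since one function is total and the other single-valued. -/
theorem hom_ext_of_imp {A B : NSet h} {f g : A ⟶ B}
    (hfg : ∀ a b, pair a b ∈ₙ NHom.graph f → pair a b ∈ₙ NHom.graph g) : f = g := by
  refine hom_ext fun a b => ⟨hfg a b, fun hab => ?_⟩
  obtain ⟨b', hb', -⟩ := (NHom.isFun f).2 a ((NHom.isFun g).dom h hab).1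
  rwa [(NHom.isFun g).uniq h hab (hfg a b' hb')]

theorem hom_tensor_ext {A B C : NSet h} {f g : A ⊗ C ⟶ B}
    (hfg : ∀ a c b, pair (pair a c) b ∈ₙ NHom.graph f → pair (pair a c) b ∈ₙ NHom.graph g) :
    f = g := by
  refine hom_ext_of_imp fun p b hp => ?_
  obtain ⟨a, _, c, _, rfl⟩ := (mem_prod _ _ _).mp ((NHom.isFun f).dom h hp).1
  exact hfg a c b hp

/-- This reduces the monoidal notation to the concrete projections and pairings, where membership of
pairs can be computed. -/
theorem whiskerLeft_eq_prodLift (A : NSet h) {C D : NSet h} (k : C ⟶ D) :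
    A ◁ k = prodLift (prodFst A C) (prodSnd A C ≫ k) :=
  eq_lift _ _ _ (CartesianMonoidalCategory.whiskerLeft_fst A k)
    (CartesianMonoidalCategory.whiskerLeft_snd A k)

theorem pair_mem_whiskerLeft_comp {A B C D : NSet h} (k : C ⟶ D) (g : A ⊗ D ⟶ B) (a c b : M) :
    pair (pair a c) b ∈ₙ NHom.graph (A ◁ k ≫ g) ↔
      ∃ d, pair c d ∈ₙ NHom.graph k ∧ pair (pair a d) b ∈ₙ NHom.graph g := by
  rw [pair_mem_comp, whiskerLeft_eq_prodLift]
  constructor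
  · rintro ⟨p, hp, hpb⟩
    obtain ⟨a', _, d, _, rfl⟩ := (mem_prod _ _ _).mp ((NHom.isFun g).dom h hpb).1
    obtain ⟨h₁, h₂⟩ := (pair_mem_lift _ _ _ _ _).mp hp
    obtain ⟨_, _, rfl⟩ := (pair_mem_fst _ _ _ _ _).mp h₁
    obtain ⟨c', h₃, h₄⟩ := (pair_mem_comp _ _ _ _).mp h₂
    obtain ⟨_, _, rfl⟩ := (pair_mem_snd _ _ _ _ _).mp h₃
    exact ⟨d, h₄, hpb⟩
  · rintro ⟨d, hd, hb⟩
    have ha := ((pair_mem_prod h _ _ _ _).mp ((NHom.isFun g).dom h hb).1).1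
    have hc := ((NHom.isFun k).dom h hd).1
    exact ⟨pair a d, (pair_mem_lift _ _ _ _ _).mpr
      ⟨(pair_mem_fst _ _ _ _ _).mpr ⟨ha, hc, rfl⟩,
        (pair_mem_comp _ _ _ _).mpr ⟨c, (pair_mem_snd _ _ _ _ _).mpr ⟨ha, hc, rfl⟩, hd⟩⟩, hb⟩

theorem pair_mem_T_map {A B : NSet h} (f : A ⟶ B) (a b : M) :
    pair (sing a) (sing b) ∈ₙ NHom.graph (T.map f) ↔ pair a b ∈ₙ NHom.graph f := by
  refine ((isGraph_T _).pair_mem h).trans ⟨?_, fun hab => ⟨a, b, hab, rfl, rfl⟩⟩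
  rintro ⟨a', b', hab, ha, hb⟩
  rwa [sing_inj ha, sing_inj hb]

theorem pair_mem_funFunctor_map (A : NSet h) {B C : NSet h} (g : B ⟶ C) (φ ψ : M) :
    pair φ ψ ∈ₙ NHom.graph ((funFunctor A).map g) ↔
      φ ∈ₙ funSet A.set B.set ∧ ψ = compSet φ (NHom.graph g) :=
  (isGraph_postcomp _ _).pair_mem h

theorem pair_mem_ev {A B : NSet h} (a φ b : M) :
    pair (pair (sing a) φ) (sing b) ∈ₙ NHom.graph (ev A B) ↔
      φ ∈ₙ funSet A.set B.set ∧ pair a b ∈ₙ φ := by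
  refine (NHom.pair_mem_ofRel ..).trans ⟨?_, fun H => ⟨φ, H.1, a, b, H.2, rfl, rfl⟩⟩
  rintro ⟨φ', hφ, a', b', hab, e, e'⟩
  obtain ⟨ha, rfl⟩ := h _ _ _ _ e
  rw [sing_inj ha, sing_inj e']
  exact ⟨hφ, hab⟩

theorem hom_T_tensor_ext {A B C : NSet h} {f g : T.obj A ⊗ C ⟶ T.obj B}
    (hfg : ∀ a c b, pair (pair (sing a) c) (sing b) ∈ₙ NHom.graph f →
      pair (pair (sing a) c) (sing b) ∈ₙ NHom.graph g) : f = g := by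
  refine hom_tensor_ext fun x c y hxy => ?_
  obtain ⟨hx, hy⟩ := (NHom.isFun f).dom h hxy
  obtain ⟨a, _, rfl⟩ := (mem_singImage _ _).mp ((pair_mem_prod h _ _ _ _).mp hx).1
  obtain ⟨b, _, rfl⟩ := (mem_singImage _ _).mp hy
  exact hfg a c b hxy

/-! ## The universal property of the pseudo-evaluation -/

theorem isGraph_curry_section (g c : M) : IsGraph fun a b => pair (pair (sing a) c) (sing b) ∈ₙ g :=
  isGraph (σ := ![6, 5]) (k := 0)
    (R := fun v a b => pair (pair (sing a) (v 1)) (sing b) ∈ₙ v 0)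
    (ST.pair_mem (k := 1) (ST.pair (k := 1) ST.last.weak.sing (ST.var' 1 rfl).weak.weak)
      ST.last.sing (ST.var' 0 rfl).weak.weak) ![g, c]

/-- The type count behind the first adjunction: with `a` and `b` at type 4, both `c` and its section
are at type 5, so they can be paired. -/
theorem isGraph_curry (C g : M) : IsGraph fun c φ =>
    c ∈ₙ C ∧ φ = graph fun a b => pair (pair (sing a) c) (sing b) ∈ₙ g := by
  refine isGraph (σ := ![6, 6]) (k := 1)
    (R := fun v c φ => c ∈ₙ v 0 ∧ φ = graph fun a b => pair (pair (sing a) c) (sing b) ∈ₙ v 1)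
    (SP.and ?_ ?_) ![C, g]
  · exact ST.mem 5 ST.last.weak (ST.var' 0 rfl).weak.weak
  · refine ST.eq 5 ST.last (ST.graph (k := 0) ?_)
    exact ST.pair_mem (k := 1) (ST.pair (k := 1) ST.last.weak.sing ST.last.weak.weak.weak)
      ST.last.sing (ST.var' 1 rfl).weak.weak.weak.weak

/-- The function `c ↦ {⟨a, b⟩ : g ⟨{a}, c⟩ = {b}}`. -/
noncomputable def curry {A B C : NSet h} (g : T.obj A ⊗ C ⟶ T.obj B) :
    C ⟶ (funFunctor A).obj B :=
  NHom.ofRel _ (isGraph_curry C.set (NHom.graph g))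
    (by
      rintro c _ ⟨hc, rfl⟩
      refine ⟨hc, (mem_funSet _ _ _).mpr ((isGraph_curry_section _ _).isFun h ?_ ?_ ?_)⟩
      · intro a b hab
        obtain ⟨h₁, h₂⟩ := (NHom.isFun g).dom h hab
        exact ⟨(sing_mem_singImage _ _).mp ((pair_mem_prod h _ _ _ _).mp h₁).1,
          (sing_mem_singImage _ _).mp h₂⟩
      · intro a ha
        obtain ⟨y, hy, -⟩ := (NHom.isFun g).2 (pair (sing a) c)
          ((pair_mem_prod h _ _ _ _).mpr ⟨(sing_mem_singImage _ _).mpr ha, hc⟩)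
        obtain ⟨b, _, rfl⟩ := (mem_singImage _ _).mp ((NHom.isFun g).dom h hy).2
        exact ⟨b, hy⟩
      · exact fun a b b' hb hb' => sing_inj ((NHom.isFun g).uniq h hb hb'))
    (fun c hc => ⟨_, hc, rfl⟩)
    (by rintro c _ _ ⟨_, rfl⟩ ⟨_, rfl⟩; rfl)

theorem pair_mem_whiskerLeft_ev {A B C : NSet h} (k : C ⟶ (funFunctor A).obj B) (a c b : M) :
    pair (pair (sing a) c) (sing b) ∈ₙ NHom.graph (T.obj A ◁ k ≫ ev A B) ↔
      ∃ φ, pair c φ ∈ₙ NHom.graph k ∧ pair a b ∈ₙ φ := by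
  simp only [pair_mem_whiskerLeft_comp, pair_mem_ev]
  exact ⟨fun ⟨φ, hφ, _, hab⟩ => ⟨φ, hφ, hab⟩,
    fun ⟨φ, hφ, hab⟩ => ⟨φ, hφ, ((NHom.isFun k).dom h hφ).2, hab⟩⟩

theorem whiskerLeft_curry_ev {A B C : NSet h} (g : T.obj A ⊗ C ⟶ T.obj B) :
    T.obj A ◁ curry g ≫ ev A B = g := by
  refine hom_T_tensor_ext fun a c b H => ?_
  obtain ⟨φ, hφ, hab⟩ := (pair_mem_whiskerLeft_ev _ _ _ _).mp H
  obtain ⟨_, rfl⟩ := (NHom.pair_mem_ofRel ..).mp hφ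
  exact ((isGraph_curry_section _ _).pair_mem h).mp hab

/-- The composite with ev' records, for each `c`, all pairs ⟨a, b⟩ in the function assigned to `c`,
and a function is determined by its pairs. -/
theorem whiskerLeft_ev_injective {A B C : NSet h} {k k' : C ⟶ (funFunctor A).obj B}
    (e : T.obj A ◁ k ≫ ev A B = T.obj A ◁ k' ≫ ev A B) : k = k' := by
  refine hom_ext_of_imp fun c φ hφ => ?_
  obtain ⟨hc, hφs⟩ := (NHom.isFun k).dom h hφ
  obtain ⟨ψ, hψ, -⟩ := (NHom.isFun k').2 c hc
  have hψs := ((NHom.isFun k').dom h hψ).2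
  suffices φ = ψ by rwa [this]
  refine ((mem_funSet _ _ _).mp hφs).ext ((mem_funSet _ _ _).mp hψs) fun a b => ?_
  have h₁ := pair_mem_whiskerLeft_ev k a c b
  rw [e, pair_mem_whiskerLeft_ev] at h₁
  constructor
  · intro hab
    obtain ⟨ψ', hψ', hab'⟩ := h₁.mpr ⟨φ, hφ, hab⟩
    rwa [(NHom.isFun k').uniq h hψ hψ']
  · intro hab
    obtain ⟨φ', hφ', hab'⟩ := h₁.mp ⟨ψ, hψ, hab⟩
    rwa [(NHom.isFun k).uniq h hφ hφ']

theorem existsUnique_whiskerLeft_ev {A B C : NSet h} (g : T.obj A ⊗ C ⟶ T.obj B) :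
    ∃! k : C ⟶ (funFunctor A).obj B, T.obj A ◁ k ≫ ev A B = g :=
  ⟨curry g, whiskerLeft_curry_ev g,
    fun _ hk => whiskerLeft_ev_injective (hk.trans (whiskerLeft_curry_ev g).symm)⟩

/-- Both sides send ⟨{a}, φ⟩ to {f(φ(a))}. This gives naturality in the target of the first
adjunction. -/
theorem ev_naturality (A : NSet h) {B B' : NSet h} (f : B ⟶ B') :
    T.obj A ◁ (funFunctor A).map f ≫ ev A B' = ev A B ≫ T.map f := by
  refine hom_T_tensor_ext fun a φ b H => ?_
  obtain ⟨ψ, hψ, hab⟩ := (pair_mem_whiskerLeft_ev _ _ _ _).mp H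
  obtain ⟨hφ, rfl⟩ := (pair_mem_funFunctor_map _ _ _ _).mp hψ
  obtain ⟨b', h₁, h₂⟩ := (pair_mem_compSet h _ _ _ _).mp hab
  exact (pair_mem_comp _ _ _ _).mpr
    ⟨sing b', (pair_mem_ev _ _ _).mpr ⟨hφ, h₁⟩, (pair_mem_T_map _ _ _).mpr h₂⟩

/-- The relative adjunction `(TA × -) ⊣_T (A ⇒ -)` with counit `ev'`. -/
noncomputable def rightRelAdj (A : NSet h) :
    RightRelAdj (tensorLeft (T.obj A)) T (funFunctor A) where
  homEquiv C B := Equiv.ofBijective (fun k => T.obj A ◁ k ≫ ev A B)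
    ⟨fun _ _ e => whiskerLeft_ev_injective e, fun g => ⟨curry g, whiskerLeft_curry_ev g⟩⟩
  naturality_left f g := by
    change T.obj A ◁ (f ≫ g) ≫ ev A _ = T.obj A ◁ f ≫ T.obj A ◁ g ≫ ev A _
    rw [MonoidalCategory.whiskerLeft_comp, Category.assoc]
  naturality_right g f := by
    change T.obj A ◁ (g ≫ (funFunctor A).map f) ≫ ev A _ = (T.obj A ◁ g ≫ ev A _) ≫ T.map f
    rw [MonoidalCategory.whiskerLeft_comp, Category.assoc, Category.assoc, ev_naturality]

theorem rightRelAdj_counit (A B : NSet h) : (rightRelAdj A).counit B = ev A B := by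
  change T.obj A ◁ 𝟙 ((funFunctor A).obj B) ≫ ev A B = ev A B
  rw [MonoidalCategory.whiskerLeft_id, Category.id_comp]

/-! ## The second relative adjunction -/

theorem isGraph_transpose_section (g c : M) : IsGraph fun a b => pair (pair a c) b ∈ₙ g :=
  isGraph (σ := ![5, 4]) (k := 0) (R := fun v a b => pair (pair a (v 1)) b ∈ₙ v 0)
    (ST.pair_mem (k := 0) (ST.pair (k := 0) ST.last.weak (ST.var' 1 rfl).weak.weak)
      ST.last (ST.var' 0 rfl).weak.weak) ![g, c]

/-- The type count behind the second adjunction: `a`, `b` and `c` are all at type 4 and the section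
at type 5, so it must be paired with {c}. -/
theorem isGraph_transpose (C g : M) : IsGraph fun x φ =>
    ∃ c, c ∈ₙ C ∧ x = sing c ∧ φ = graph fun a b => pair (pair a c) b ∈ₙ g := by
  refine isGraph (σ := ![5, 5]) (k := 1) (R := fun v x φ =>
    ∃ c, c ∈ₙ v 0 ∧ x = sing c ∧ φ = graph fun a b => pair (pair a c) b ∈ₙ v 1) ?_ ![C, g]
  refine SP.exists 4 (SP.and ?_ (SP.and ?_ ?_))
  · exact ST.mem 4 ST.last (ST.var' 0 rfl).weak.weak.weak
  · exact ST.eq 5 ST.last.weak.weak ST.last.sing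
  · refine ST.eq 5 ST.last.weak (ST.graph (k := 0) ?_)
    exact ST.pair_mem (k := 0) (ST.pair (k := 0) ST.last.weak ST.last.weak.weak)
      ST.last (ST.var' 1 rfl).weak.weak.weak.weak.weak

/-- The function `{c} ↦ {⟨a, b⟩ : g ⟨a, c⟩ = b}`. -/
noncomputable def transpose {A B C : NSet h} (g : A ⊗ C ⟶ B) : T.obj C ⟶ (funFunctor A).obj B :=
  NHom.ofRel _ (isGraph_transpose C.set (NHom.graph g))
    (by
      rintro _ _ ⟨c, hc, rfl, rfl⟩
      refine ⟨(sing_mem_singImage _ _).mpr hc,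
        (mem_funSet _ _ _).mpr ((isGraph_transpose_section _ _).isFun h ?_ ?_ ?_)⟩
      · intro a b hab
        obtain ⟨h₁, h₂⟩ := (NHom.isFun g).dom h hab
        exact ⟨((pair_mem_prod h _ _ _ _).mp h₁).1, h₂⟩
      · intro a ha
        obtain ⟨b, hb, -⟩ := (NHom.isFun g).2 (pair a c) ((pair_mem_prod h _ _ _ _).mpr ⟨ha, hc⟩)
        exact ⟨b, hb⟩
      · exact fun a b b' hb hb' => (NHom.isFun g).uniq h hb hb')
    (by
      intro x hx
      obtain ⟨c, hc, rfl⟩ := (mem_singImage _ _).mp hx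
      exact ⟨_, c, hc, rfl, rfl⟩)
    (by
      rintro _ _ _ ⟨c, _, rfl, rfl⟩ ⟨c', _, e, rfl⟩
      rw [sing_inj e])

theorem pair_mem_of_transpose {A B C : NSet h} {g : A ⊗ C ⟶ B} {c φ : M}
    (hφ : pair (sing c) φ ∈ₙ NHom.graph (transpose g)) (a b : M) :
    pair a b ∈ₙ φ ↔ pair (pair a c) b ∈ₙ NHom.graph g := by
  obtain ⟨c', _, e, rfl⟩ := (NHom.pair_mem_ofRel ..).mp hφ
  rw [sing_inj e]
  exact (isGraph_transpose_section _ _).pair_mem h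

/-- A criterion on values: an arrow out of TC is the transpose of `g` once its value at each {c} has
the pairs prescribed by `g`. Surjectivity and both naturality laws are checked through it. -/
theorem eq_transpose {A B C : NSet h} {g : A ⊗ C ⟶ B} {m : T.obj C ⟶ (funFunctor A).obj B}
    (H : ∀ c φ, pair (sing c) φ ∈ₙ NHom.graph m →
      ∀ a b, pair a b ∈ₙ φ ↔ pair (pair a c) b ∈ₙ NHom.graph g) : transpose g = m := by
  refine hom_ext_of_imp fun x φ hφ => ?_
  obtain ⟨hx, hφs⟩ := (NHom.isFun (transpose g)).dom h hφ
  obtain ⟨c, _, rfl⟩ := (mem_singImage _ _).mp hx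
  obtain ⟨ψ, hψ, -⟩ := (NHom.isFun m).2 _ hx
  have hψs := ((NHom.isFun m).dom h hψ).2
  have : φ = ψ := ((mem_funSet _ _ _).mp hφs).ext ((mem_funSet _ _ _).mp hψs) fun a b =>
    (pair_mem_of_transpose hφ a b).trans (H c ψ hψ a b).symm
  rwa [this]

theorem transpose_injective {A B C : NSet h} :
    Function.Injective (transpose : (A ⊗ C ⟶ B) → (T.obj C ⟶ (funFunctor A).obj B)) := by
  intro g g' e
  refine hom_tensor_ext fun a c b hb => ?_
  have hc := ((pair_mem_prod h _ _ _ _).mp ((NHom.isFun g).dom h hb).1).2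
  obtain ⟨φ, hφ, -⟩ := (NHom.isFun (transpose g)).2 (sing c) ((sing_mem_singImage _ _).mpr hc)
  exact (pair_mem_of_transpose (e ▸ hφ) a b).mp ((pair_mem_of_transpose hφ a b).mpr hb)

/-- Evaluation at `a` of the value at {c} is stratified: `a`, `b`, `c` have type 4, while {c} and
`φ` have type 5. -/
theorem isGraph_untranspose (m : M) : IsGraph fun p b =>
    ∃ a, ∃ c, ∃ φ, p = pair a c ∧ pair (sing c) φ ∈ₙ m ∧ pair a b ∈ₙ φ := by
  refine isGraph (σ := ![6]) (k := 0) (R := fun v p b =>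
    ∃ a, ∃ c, ∃ φ, p = pair a c ∧ pair (sing c) φ ∈ₙ v 0 ∧ pair a b ∈ₙ φ) ?_ ![m]
  refine SP.exists 4 ?_
  refine SP.exists 4 ?_
  refine SP.exists 5 (SP.and ?_ (SP.and ?_ ?_))
  · exact ST.eq 4 ST.last.weak.weak.weak.weak (ST.pair (k := 0) ST.last.weak.weak ST.last.weak)
  · exact ST.pair_mem (k := 1) ST.last.weak.sing ST.last (ST.var' 0 rfl).weak.weak.weak.weak.weak
  · exact ST.pair_mem (k := 0) ST.last.weak.weak ST.last.weak.weak.weak ST.last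

/-- The function `⟨a, c⟩ ↦ m {c} (a)`. -/
noncomputable def untranspose {A B C : NSet h} (m : T.obj C ⟶ (funFunctor A).obj B) :
    A ⊗ C ⟶ B :=
  NHom.ofRel (A := prodObj A C) _ (isGraph_untranspose (NHom.graph m))
    (by
      rintro _ b ⟨a, c, φ, rfl, hφ, hab⟩
      obtain ⟨h₁, h₂⟩ := (NHom.isFun m).dom h hφ
      have := ((mem_funSet _ _ _).mp h₂).dom h hab
      exact ⟨(pair_mem_prod h _ _ _ _).mpr ⟨this.1, (sing_mem_singImage _ _).mp h₁⟩, this.2⟩)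
    (by
      intro p hp
      obtain ⟨a, ha, c, hc, rfl⟩ := (mem_prod _ _ _).mp hp
      obtain ⟨φ, hφ, -⟩ := (NHom.isFun m).2 (sing c) ((sing_mem_singImage _ _).mpr hc)
      obtain ⟨b, hb, -⟩ := ((mem_funSet _ _ _).mp ((NHom.isFun m).dom h hφ).2).2 a ha
      exact ⟨b, a, c, φ, rfl, hφ, hb⟩)
    (by
      rintro _ b b' ⟨a, c, φ, rfl, hφ, hab⟩ ⟨a', c', φ', e, hφ', hab'⟩
      obtain ⟨rfl, rfl⟩ := h _ _ _ _ e
      obtain rfl := (NHom.isFun m).uniq h hφ hφ'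
      exact ((mem_funSet _ _ _).mp ((NHom.isFun m).dom h hφ).2).uniq h hab hab')

theorem transpose_untranspose {A B C : NSet h} (m : T.obj C ⟶ (funFunctor A).obj B) :
    transpose (untranspose m) = m := by
  refine eq_transpose fun c φ hφ a b => Iff.trans ?_ (NHom.pair_mem_ofRel ..).symm
  constructor
  · exact fun hab => ⟨a, c, φ, rfl, hφ, hab⟩
  · rintro ⟨a', c', φ', e, hφ', hab⟩
    obtain ⟨rfl, rfl⟩ := h _ _ _ _ e
    rwa [(NHom.isFun m).uniq h hφ hφ']

theorem transpose_whiskerLeft_comp {A B C' C : NSet h} (f : C' ⟶ C) (g : A ⊗ C ⟶ B) :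
    transpose (A ◁ f ≫ g) = T.map f ≫ transpose g := by
  refine eq_transpose fun c φ hφ a b => ?_
  obtain ⟨x, hx, hxφ⟩ := (pair_mem_comp _ _ _ _).mp hφ
  obtain ⟨d, _, rfl⟩ := (mem_singImage _ _).mp ((NHom.isFun (T.map f)).dom h hx).2
  have hcd := (pair_mem_T_map _ _ _).mp hx
  rw [pair_mem_of_transpose hxφ, pair_mem_whiskerLeft_comp]
  refine ⟨fun hb => ⟨d, hcd, hb⟩, fun ⟨d', hcd', hb⟩ => ?_⟩
  -- Single-valuedness of `f` identifies `d'` with the `d` whose singleton is the value of `T.map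
  -- f`.
  rwa [(NHom.isFun f).uniq h hcd hcd']

theorem transpose_comp {A B B' C : NSet h} (g : A ⊗ C ⟶ B) (f : B ⟶ B') :
    transpose (g ≫ f) = transpose g ≫ (funFunctor A).map f := by
  refine eq_transpose fun c ψ hψ a b => ?_
  obtain ⟨φ, hφ, hφψ⟩ := (pair_mem_comp _ _ _ _).mp hψ
  obtain ⟨_, rfl⟩ := (pair_mem_funFunctor_map _ _ _ _).mp hφψ
  simp only [pair_mem_compSet h, pair_mem_comp, pair_mem_of_transpose hφ]

/-- The relative adjunction `(A × -) _T⊣ (A ⇒ -)`. -/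
noncomputable def leftRelAdj (A : NSet h) : LeftRelAdj (tensorLeft A) T (funFunctor A) where
  homEquiv C B := Equiv.ofBijective (fun g : A ⊗ C ⟶ B => transpose g)
    ⟨transpose_injective, fun m => ⟨untranspose m, transpose_untranspose m⟩⟩
  naturality_left f g := transpose_whiskerLeft_comp f g
  naturality_right g f := transpose_comp g f

end Closed

end NF

theorem mainTheorem1 (M : Type u) [setLang.Structure M] [NFModel M] :
    ∃ h : NF.QuinePairing M,
      (∀ (A B C : NF.NSet h) (g : NF.T.obj A ⊗ C ⟶ NF.T.obj B),
        ∃! k : C ⟶ (NF.funFunctor A).obj B, NF.T.obj A ◁ k ≫ NF.ev A B = g) ∧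
      (∀ A : NF.NSet h,
        ∃ adj : NF.RightRelAdj (tensorLeft (NF.T.obj A)) NF.T (NF.funFunctor A),
          ∀ B : NF.NSet h, adj.counit B = NF.ev A B) ∧
      (∀ A : NF.NSet h, Nonempty (NF.LeftRelAdj (tensorLeft A) NF.T (NF.funFunctor A))) ∧
      NF.PseudoCartesianClosed (NF.NSet h) NF.T :=
  ⟨NF.quinePairing, fun _ _ _ g => NF.existsUnique_whiskerLeft_ev g,
    fun A => ⟨NF.rightRelAdj A, NF.rightRelAdj_counit A⟩, fun A => ⟨NF.leftRelAdj A⟩,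
    fun A => ⟨NF.funFunctor A, ⟨NF.rightRelAdj A⟩, ⟨NF.leftRelAdj A⟩⟩⟩
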